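/- For a row-finite directed graph $E$ (vertices $E_0$, edges $E_1$, source and range maps $s,r$), let $C^*(E)$ be its graph C*-algebra: the universal C*-algebra generated by mutually orthogonal projections $P_v$ ($v\in E_0$) and partial isometries $S_e$ ($e\in E_1$) with $S_e^*S_e=P_{r(e)}$ for every edge $e$ and $\sum_{s(e)=v}S_eS_e^*=P_v$ for every vertex $v$ that is not a sink. It carries the gauge action of $U(1)$: $P_v\mapsto P_v$, $S_e\mapsto\lambda S_e$. For a saturated hereditary set $H\subseteq E_0$, $E/H$ denotes the graph obtained from $E$ by removing the vertices in $H$ and the edges with range in $H$, and $C^*(E)\to C^*(E/H)$ is the canonical *-homomorphism ($P_v\mapsto P_v$ for $v\notin H$, $S_e\mapsto S_e$ for $r(e)\notin H$, all other generators $\mapsto 0$). For $l\ge 0$ let $L^3_l$ be the graph with vertices $v^0_0,v^1_0,\dots,v^1_{l-1}$, a loop $e^0_0$ at $v^0_0$, and, for each $0\le i\le l-1$, one edge $e^{01}_i$ from $v^0_0$ to $v^1_i$ and one loop $e^1_i$ at $v^1_i$. For $l\ge 1$ let $Q_l$ be $L^3_l$ with the loop $e^1_{l-1}$ removed, and let $H=\{v^1_0,\dots,v^1_{l-2}\}$,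 a saturated hereditary set of vertices both of $Q_l$ and of $L^3_{l-1}$. Let $\mathcal T$ be the Toeplitz algebra, i.e. the unital C*-algebra generated by the unilateral shift $s$ on $\ell^2(\mathbb N)$, and let $\sigma:\mathcal T\to C(S^1)$ be the symbol map, i.e. the *-homomorphism with $\sigma(s)=u$, the standard unitary generator of $C(S^1)$. **Lemma.** Let $l\ge 1$. There are isomorphisms $C^*(Q_l/H)\cong\mathcal T$ and $C^*(L^3_{l-1}/H)\cong C(S^1)$ that send $S_{e^0_0}+S_{e^{01}_{l-1}}$ to $s$ and $S_{e^0_0}$ to $u$, respectively. Use them as identifications, together with $Q_l/\{v^1_{l-1}\}=L^3_{l-1}$, and let $$\chi_1:C^*(Q_l)\to C^*(L^3_{l-1}),\qquad \chi_2:C^*(Q_l)\to C^*(Q_l/H)\cong\mathcal T,\qquad g:C^*(L^3_{l-1})\to C^*(L^3_{l-1}/H)\cong C(S^1)$$ be the canonical *-homomorphisms. They are the quotient maps (surjective, with the indicated kernel) by the closed ideals generated by $P_{v^1_{l-1}}$, by $\{P_v:v\in H\}$, and by $\{P_v:v\in H\}$, respectively. The maps $\chi_1,\chi_2,g,\sigma$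 are $U(1)$-equivariant for the gauge actions (on $\mathcal T$: the gauge action of $C^*(Q_l/H)$, $s\mapsto\lambda s$) and for the rotation action $u\mapsto\lambda u$ on $C(S^1)$. The square $$\begin{array}{ccc} C^*(Q_l)&\xrightarrow{\ \chi_2\ }&\mathcal T\\ {\scriptstyle\chi_1}\downarrow& &\downarrow{\scriptstyle\sigma}\\ C^*(L^3_{l-1})&\xrightarrow{\ g\ }&C(S^1)\end{array}$$ is a pullback diagram of C*-algebras: it commutes, and $x\mapsto(\chi_1(x),\chi_2(x))$ is an isomorphism of $C^*(Q_l)$ onto $\{(a,b)\in C^*(L^3_{l-1})\times\mathcal T: g(a)=\sigma(b)\}$. -/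

import Mathlib

noncomputable section

namespace GraphCStar

open UniformSpace

/-! ### The free `*`-algebra on a set of generators -/

/-- Nonempty words in the letters `x` and `x*`; the letter `(x, false)` is `x`, and
`(x, true)` is `x*`. -/
abbrev StarWord (X : Type) : Type := FreeSemigroup (X × Bool)

/-- The involution on words: reverse the word and exchange the letters `x` and `x*`. -/
def starWordHom (X : Type) : StarWord X →ₙ* (StarWord X)ᵐᵒᵖ :=
  FreeSemigroup.lift fun a => MulOpposite.op (FreeSemigroup.of (a.1, !a.2))

instance (X : Type) : StarMul (StarWord X) where
  star w := (starWordHom X w).unop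
  star_involutive w := by
    induction w using FreeSemigroup.recOnMul with
    | ih1 x => simp [starWordHom]
    | ih2 x y hx hy =>
      simp only [map_mul, MulOpposite.unop_mul] at hx hy ⊢
      rw [hx, hy]
  star_mul a b := by simp

theorem star_of {X : Type} (a : X × Bool) :
    star (FreeSemigroup.of a : StarWord X) = FreeSemigroup.of (a.1, !a.2) := rfl

/-- The free (non-unital) complex `*`-algebra on `X`: noncommutative polynomials without constant
term in the letters `x` and `x*`. -/
def FreeStarAlg (X : Type) : Type := MonoidAlgebra ℂ (StarWord X)

instance (X : Type) : NonUnitalRing (FreeStarAlg X) :=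
  inferInstanceAs (NonUnitalRing (MonoidAlgebra ℂ (StarWord X)))

instance (X : Type) : Module ℂ (FreeStarAlg X) :=
  inferInstanceAs (Module ℂ (MonoidAlgebra ℂ (StarWord X)))

instance (X : Type) : IsScalarTower ℂ (FreeStarAlg X) (FreeStarAlg X) :=
  inferInstanceAs (IsScalarTower ℂ (MonoidAlgebra ℂ (StarWord X)) (MonoidAlgebra ℂ (StarWord X)))

instance (X : Type) : SMulCommClass ℂ (FreeStarAlg X) (FreeStarAlg X) :=
  inferInstanceAs (SMulCommClass ℂ (MonoidAlgebra ℂ (StarWord X)) (MonoidAlgebra ℂ (StarWord X)))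

namespace FreeStarAlg

variable {X : Type}

/-- The monomial `c • w`. -/
def mono (w : StarWord X) (c : ℂ) : FreeStarAlg X := MonoidAlgebra.single w c

/-- The generator `x`. -/
def gen (x : X) : FreeStarAlg X := mono (FreeSemigroup.of (x, false)) 1

theorem induction {p : FreeStarAlg X → Prop} (x : FreeStarAlg X) (h0 : p 0)
    (hadd : ∀ x y, p x → p y → p (x + y)) (hmono : ∀ w c, p (mono w c)) : p x :=
  MonoidAlgebra.induction_linear x h0 hadd hmono

theorem mono_mul_mono (v w : StarWord X) (c d : ℂ) :
    mono v c * mono w d = mono (v * w) (c * d) :=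
  MonoidAlgebra.single_mul_single ..

theorem smul_mono (a : ℂ) (w : StarWord X) (c : ℂ) : a • mono w c = mono w (a * c) :=
  MonoidAlgebra.smul_single ..

/-- The involution, as an additive map. -/
def starAdd : FreeStarAlg X →+ FreeStarAlg X :=
  (Finsupp.liftAddHom fun w : StarWord X =>
    (MonoidAlgebra.singleAddHom (R := ℂ) (star w)).comp
      (starAddEquiv (R := ℂ)).toAddMonoidHom).comp
    (MonoidAlgebra.coeffAddEquiv (R := ℂ) (M := StarWord X)).toAddMonoidHom

theorem starAdd_mono (w : StarWord X) (c : ℂ) : starAdd (mono w c) = mono (star w) (star c) := by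
  refine (Finsupp.liftAddHom_apply_single _ w c).trans ?_
  rfl

/-- The involution: conjugate-linear, antimultiplicative, exchanging `x` and `x*`. -/
instance : StarRing (FreeStarAlg X) where
  star := starAdd
  star_involutive x := by
    induction x using induction with
    | h0 => simp
    | hadd x y hx hy => rw [map_add, map_add, hx, hy]
    | hmono w c => simp [starAdd_mono]
  star_mul x y := by
    induction x using induction with
    | h0 => simp
    | hadd x x' hx hx' => rw [add_mul, map_add, map_add, hx, hx', mul_add]
    | hmono w c =>
      induction y using induction with
      | h0 => simp
      | hadd y y' hy hy' => rw [mul_add, map_add, map_add, hy, hy', add_mul]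
      | hmono v d => simp [starAdd_mono, mono_mul_mono, mul_comm]
  star_add x y := map_add _ x y

theorem star_mono (w : StarWord X) (c : ℂ) : star (mono w c) = mono (star w) (star c) :=
  starAdd_mono w c

instance : StarModule ℂ (FreeStarAlg X) where
  star_smul a x := by
    induction x using induction with
    | h0 => simp
    | hadd x y hx hy => rw [smul_add, star_add, star_add, hx, hy, smul_add]
    | hmono w c => simp [smul_mono, star_mono]

section Lift

variable {B : Type*} [NonUnitalCStarAlgebra B] (f : X → B)

/-- The value of a letter. -/
def letterVal (a : X × Bool) : B := if a.2 then star (f a.1) else f a.1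

/-- The value of a word. -/
def wordVal : StarWord X →ₙ* B := FreeSemigroup.lift (letterVal f)

theorem wordVal_star (w : StarWord X) : wordVal f (star w) = star (wordVal f w) := by
  induction w using FreeSemigroup.recOnMul with
  | ih1 x => rcases x with ⟨x, _ | _⟩ <;> simp [star_of, wordVal, letterVal]
  | ih2 x y hx hy => rw [star_mul, map_mul, map_mul, star_mul, hy, hx]

/-- The `*`-homomorphism of the free `*`-algebra that sends the generator `x` to `f x`. -/
def lift : FreeStarAlg X →⋆ₙₐ[ℂ] B where
  __ := (MonoidAlgebra.liftMagma ℂ (wordVal f) : MonoidAlgebra ℂ (StarWord X) →ₙₐ[ℂ] B)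
  map_star' x := by
    let φ : FreeStarAlg X →ₙₐ[ℂ] B := (MonoidAlgebra.liftMagma ℂ (wordVal f) :
      MonoidAlgebra ℂ (StarWord X) →ₙₐ[ℂ] B)
    have hφ (w : StarWord X) (c : ℂ) : φ (mono w c) = c • wordVal f w := by
      change MonoidAlgebra.liftMagma ℂ (wordVal f) (MonoidAlgebra.single w c) = _
      simp
    change φ (star x) = star (φ x)
    induction x using induction with
    | h0 => simp
    | hadd x y hx hy => simp only [star_add, map_add, hx, hy]
    | hmono w c => simp only [star_mono, hφ, wordVal_star, star_smul]

theorem lift_mono (w : StarWord X) (c : ℂ) : lift f (mono w c) = c • wordVal f w := by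
  change MonoidAlgebra.liftMagma ℂ (wordVal f) _ = _
  simp [mono]

theorem lift_gen (x : X) : lift f (gen x) = f x := by
  rw [gen, lift_mono, one_smul]
  simp [wordVal, letterVal]

end Lift

end FreeStarAlg

/-! ### Completing a `*`-algebra with a C*-seminorm -/

namespace StarCompletion

section Ring

variable {A : Type} [NonUnitalSeminormedRing A]

/-- The continuous extension of the multiplication to the completion. -/
abbrev mulInst : Mul (Completion A) :=
  ⟨Function.curry <| (Completion.isDenseInducing_coe.prodMap Completion.isDenseInducing_coe).extend
    ((↑) ∘ Function.uncurry (fun a b : A => a * b))⟩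

attribute [local instance] mulInst

theorem coe_mul (a b : A) : ((a * b : A) : Completion A) = a * b :=
  ((Completion.isDenseInducing_coe.prodMap Completion.isDenseInducing_coe).extend_eq
    ((Completion.continuous_coe A).comp (@continuous_mul A _ _ _)) (a, b)).symm

theorem continuousMul : ContinuousMul (Completion A) where
  continuous_mul := by
    let m := (AddMonoidHom.mul : A →+ A →+ A).compr₂ Completion.toCompl
    have : Continuous fun p : A × A => m p.1 p.2 :=
      (Completion.continuous_coe A).comp continuous_mul
    have di : IsDenseInducing (Completion.toCompl : A → Completion A) :=
      Completion.isDenseInducing_coe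
    exact (di.extend_Z_bilin di this :)

attribute [local instance] continuousMul

open Completion (coe_add coe_zero norm_coe coe_smul)

/-- The completion of a seminormed algebra is a normed algebra. -/
abbrev ringInst : NonUnitalNormedRing (Completion A) where
  __ := (inferInstance : NormedAddCommGroup (Completion A))
  __ := (mulInst : Mul (Completion A))
  left_distrib a b c := by
    induction a, b, c using Completion.induction_on₃ with
    | hp => exact isClosed_eq (by fun_prop) (by fun_prop)
    | ih a b c => rw [← coe_add, ← coe_mul, ← coe_mul, ← coe_mul, ← coe_add, mul_add]
  right_distrib a b c := by
    induction a, b, c using Completion.induction_on₃ with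
    | hp => exact isClosed_eq (by fun_prop) (by fun_prop)
    | ih a b c => rw [← coe_add, ← coe_mul, ← coe_mul, ← coe_mul, ← coe_add, add_mul]
  zero_mul a := by
    induction a using Completion.induction_on with
    | hp => exact isClosed_eq (by fun_prop) continuous_const
    | ih a => rw [← coe_zero, ← coe_mul, zero_mul]
  mul_zero a := by
    induction a using Completion.induction_on with
    | hp => exact isClosed_eq (by fun_prop) continuous_const
    | ih a => rw [← coe_zero, ← coe_mul, mul_zero]
  mul_assoc a b c := by
    induction a, b, c using Completion.induction_on₃ with
    | hp => exact isClosed_eq (by fun_prop) (by fun_prop)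
    | ih a b c => rw [← coe_mul, ← coe_mul, ← coe_mul, ← coe_mul, mul_assoc]
  norm_mul_le x y := by
    induction x, y using Completion.induction_on₂ with
    | hp => exact isClosed_le (by fun_prop) (by fun_prop)
    | ih a b => simpa only [← coe_mul, norm_coe] using norm_mul_le a b

variable [StarRing A]

/-- The continuous extension of the involution to the completion. -/
abbrev starInst : Star (Completion A) := ⟨Completion.map (star : A → A)⟩

attribute [local instance] starInst

theorem continuous_star_compl : Continuous (star : Completion A → Completion A) :=
  Completion.continuous_map

variable [NormedStarGroup A]

theorem coe_star (a : A) : ((star a : A) : Completion A) = star (a : Completion A) :=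
  (Completion.map_coe (star_isometry (E := A)).uniformContinuous a).symm

/-- The completion of a seminormed `*`-algebra whose seminorm satisfies the C*-identity is a
C*-algebra. -/
abbrev cstarInst [NormedSpace ℂ A] [IsScalarTower ℂ A A] [SMulCommClass ℂ A A]
    [StarModule ℂ A] (h : ∀ a : A, ‖a‖ * ‖a‖ ≤ ‖star a * a‖) :
    NonUnitalCStarAlgebra (Completion A) where
  __ := (ringInst : NonUnitalNormedRing (Completion A))
  __ := (starInst : Star (Completion A))
  __ := (inferInstance : NormedSpace ℂ (Completion A))
  __ := (inferInstance : CompleteSpace (Completion A))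
  star_involutive x := by
    induction x using Completion.induction_on with
    | hp => exact isClosed_eq (continuous_star_compl.comp continuous_star_compl) continuous_id
    | ih a => rw [← coe_star, ← coe_star, star_star]
  star_mul x y := by
    induction x, y using Completion.induction_on₂ with
    | hp =>
      exact isClosed_eq (continuous_star_compl.comp continuous_mul)
        ((continuous_star_compl.comp continuous_snd).mul
          (continuous_star_compl.comp continuous_fst))
    | ih a b => rw [← coe_mul, ← coe_star, ← coe_star, ← coe_star, ← coe_mul, star_mul]
  star_add x y := by
    induction x, y using Completion.induction_on₂ with
    | hp =>
      exact isClosed_eq (continuous_star_compl.comp continuous_add)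
        ((continuous_star_compl.comp continuous_fst).add
          (continuous_star_compl.comp continuous_snd))
    | ih a b => rw [← coe_add, ← coe_star, ← coe_star, ← coe_star, ← coe_add, star_add]
  norm_mul_self_le x := by
    induction x using Completion.induction_on with
    | hp => exact isClosed_le (by fun_prop) ((continuous_star_compl.mul continuous_id).norm)
    | ih a =>
      rw [← coe_star, ← coe_mul, norm_coe, norm_coe]
      exact h a
  smul_assoc c x y := by
    simp only [smul_eq_mul]
    induction x, y using Completion.induction_on₂ with
    | hp =>
      exact isClosed_eq ((continuous_fst.const_smul c).mul continuous_snd)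
        (continuous_mul.const_smul c)
    | ih a b => rw [← coe_smul, ← coe_mul, ← coe_mul, ← coe_smul, smul_mul_assoc]
  smul_comm c x y := by
    simp only [smul_eq_mul]
    induction x, y using Completion.induction_on₂ with
    | hp =>
      exact isClosed_eq (continuous_mul.const_smul c)
        (continuous_fst.mul (continuous_snd.const_smul c))
    | ih a b => rw [← coe_mul, ← coe_smul, ← coe_smul, ← coe_mul, mul_smul_comm]
  star_smul c x := by
    induction x using Completion.induction_on with
    | hp =>
      exact isClosed_eq (continuous_star_compl.comp (continuous_const_smul c))
        ((continuous_const_smul (star c)).comp continuous_star_compl)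
    | ih a => rw [← coe_smul, ← coe_star, ← coe_star, ← coe_smul, star_smul]

end Ring

end StarCompletion

/-! ### Graphs and their C*-algebras -/

end GraphCStar

/-- A row-finite directed graph: multiple edges and loops are allowed, and every vertex emits
only finitely many edges. -/
structure RowFiniteGraph where
  /-- the vertices -/
  Vert : Type
  /-- the edges -/
  Edge : Type
  /-- the source map -/
  src : Edge → Vert
  /-- the range map -/
  rng : Edge → Vert
  finite_out : ∀ v, {e | src e = v}.Finite

namespace RowFiniteGraph

open GraphCStar UniformSpace

/-- The finite set of edges emitted by a vertex. -/
def out (E : RowFiniteGraph) (v : E.Vert) : Finset E.Edge := (E.finite_out v).toFinset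

theorem mem_out {E : RowFiniteGraph} {v : E.Vert} {e : E.Edge} : e ∈ E.out v ↔ E.src e = v := by
  simp [out]

/-- `v` is a sink if it emits no edge. -/
def IsSink (E : RowFiniteGraph) (v : E.Vert) : Prop := ∀ e, E.src e ≠ v

/-- Cuntz--Krieger `E`-families in a `*`-algebra: mutually orthogonal projections `P v` and partial
isometries `S e` that satisfy the Cuntz--Krieger relations. -/
structure IsCuntzKrieger (E : RowFiniteGraph) {B : Type*} [NonUnitalRing B] [StarRing B]
    (P : E.Vert → B) (S : E.Edge → B) : Prop where
  star_P : ∀ v, star (P v) = P v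
  P_mul_self : ∀ v, P v * P v = P v
  P_mul_P : ∀ v w, v ≠ w → P v * P w = 0
  partial_isometry : ∀ e, S e * star (S e) * S e = S e
  ck1 : ∀ e, star (S e) * S e = P (E.rng e)
  ck2 : ∀ v, ¬ E.IsSink v → ∑ e ∈ E.out v, S e * star (S e) = P v

/-- Noncommutative `*`-polynomials in the symbols `P v` and `S e`. -/
def PreAlg (E : RowFiniteGraph) : Type := FreeStarAlg (E.Vert ⊕ E.Edge)

section PreAlg

variable (E : RowFiniteGraph)

instance : NonUnitalRing E.PreAlg := inferInstanceAs (NonUnitalRing (FreeStarAlg _))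
instance : StarRing E.PreAlg := inferInstanceAs (StarRing (FreeStarAlg _))
instance : Module ℂ E.PreAlg := inferInstanceAs (Module ℂ (FreeStarAlg _))
instance : IsScalarTower ℂ E.PreAlg E.PreAlg :=
  inferInstanceAs (IsScalarTower ℂ (FreeStarAlg _) (FreeStarAlg _))
instance : SMulCommClass ℂ E.PreAlg E.PreAlg :=
  inferInstanceAs (SMulCommClass ℂ (FreeStarAlg _) (FreeStarAlg _))
instance : StarModule ℂ E.PreAlg := inferInstanceAs (StarModule ℂ (FreeStarAlg _))

/-- The symbol `P v`. -/
def preP (v : E.Vert) : E.PreAlg := FreeStarAlg.gen (Sum.inl v)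

/-- The symbol `S e`. -/
def preS (e : E.Edge) : E.PreAlg := FreeStarAlg.gen (Sum.inr e)

/-- The differences of the two sides of the defining relations of `C*(E)`. -/
inductive IsRelator : E.PreAlg → Prop
  | star_P (v : E.Vert) : IsRelator (star (E.preP v) - E.preP v)
  | P_mul_self (v : E.Vert) : IsRelator (E.preP v * E.preP v - E.preP v)
  | P_mul_P (v w : E.Vert) (h : v ≠ w) : IsRelator (E.preP v * E.preP w)
  | partial_isometry (e : E.Edge) :
      IsRelator (E.preS e * star (E.preS e) * E.preS e - E.preS e)
  | ck1 (e : E.Edge) : IsRelator (star (E.preS e) * E.preS e - E.preP (E.rng e))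
  | ck2 (v : E.Vert) (h : ¬ E.IsSink v) :
      IsRelator (∑ e ∈ E.out v, E.preS e * star (E.preS e) - E.preP v)

/-- The C*-seminorms on the `*`-polynomials in `P v`, `S e` that vanish on the relators. These are
the functions `x ↦ ‖φ x‖`, where `φ` is the `*`-homomorphism into a C*-algebra given by a
Cuntz--Krieger `E`-family. -/
structure IsCKSeminorm (p : Seminorm ℂ E.PreAlg) : Prop where
  mul_le : ∀ x y, p (x * y) ≤ p x * p y
  star_mul : ∀ x, p (star x * x) = p x * p x
  relator : ∀ x, E.IsRelator x → p x = 0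

end PreAlg

section Seminorm

variable {E : RowFiniteGraph} {p : Seminorm ℂ E.PreAlg}

theorem IsCKSeminorm.le_star (hp : E.IsCKSeminorm p) (x : E.PreAlg) : p x ≤ p (star x) := by
  rcases (apply_nonneg p x).eq_or_lt with h | h
  · rw [← h]; exact apply_nonneg p _
  · have := hp.mul_le (star x) x
    rw [hp.star_mul] at this
    exact le_of_mul_le_mul_right this h

theorem IsCKSeminorm.star_eq (hp : E.IsCKSeminorm p) (x : E.PreAlg) : p (star x) = p x :=
  le_antisymm (by simpa using hp.le_star (star x)) (hp.le_star x)

theorem IsCKSeminorm.congr (hp : E.IsCKSeminorm p) {x y : E.PreAlg} (h : E.IsRelator (x - y)) :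
    p x = p y := by
  have h0 := hp.relator _ h
  have h1 := map_sub_le_add p x y
  have h2 : p x ≤ p (x - y) + p y := by simpa using map_add_le_add p (x - y) y
  have h3 : p y ≤ p (y - x) + p x := by simpa using map_add_le_add p (y - x) x
  rw [map_sub_rev] at h3
  linarith

theorem IsCKSeminorm.preP_le (hp : E.IsCKSeminorm p) (v : E.Vert) : p (E.preP v) ≤ 1 := by
  have h0 : p (E.preP v * E.preP v) = p (E.preP v) := hp.congr (.P_mul_self v)
  have h1 : p ((star (E.preP v) - E.preP v) * E.preP v) ≤ 0 := by
    simpa [hp.relator _ (.star_P v)] using hp.mul_le (star (E.preP v) - E.preP v) (E.preP v)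
  have h2 := hp.star_mul (E.preP v)
  have h3 : p (star (E.preP v) * E.preP v) ≤
      p ((star (E.preP v) - E.preP v) * E.preP v) + p (E.preP v * E.preP v) := by
    simpa [sub_mul] using
      map_add_le_add p ((star (E.preP v) - E.preP v) * E.preP v) (E.preP v * E.preP v)
  nlinarith [apply_nonneg p (E.preP v)]

theorem IsCKSeminorm.preS_le (hp : E.IsCKSeminorm p) (e : E.Edge) : p (E.preS e) ≤ 1 := by
  have h0 := hp.congr (.ck1 e)
  rw [hp.star_mul] at h0
  have h1 := hp.preP_le (E.rng e)
  nlinarith [apply_nonneg p (E.preS e)]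

theorem IsCKSeminorm.gen_le (hp : E.IsCKSeminorm p) (x : E.Vert ⊕ E.Edge) :
    p (FreeStarAlg.gen x : FreeStarAlg _) ≤ 1 := by
  rcases x with v | e
  · exact hp.preP_le v
  · exact hp.preS_le e

theorem IsCKSeminorm.word_le (hp : E.IsCKSeminorm p) (w : StarWord (E.Vert ⊕ E.Edge)) :
    p (FreeStarAlg.mono w 1 : FreeStarAlg _) ≤ 1 := by
  induction w using FreeSemigroup.recOnMul with
  | ih1 a =>
    rcases a with ⟨x, _ | _⟩
    · exact hp.gen_le x
    · have h : (FreeStarAlg.mono (FreeSemigroup.of (x, true)) 1 : E.PreAlg) =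
          star (FreeStarAlg.gen x : E.PreAlg) := by
        refine Eq.trans ?_ (FreeStarAlg.star_mono _ _).symm
        simp [star_of]
      rw [h]
      exact (hp.star_eq (FreeStarAlg.gen x : FreeStarAlg _)).trans_le (hp.gen_le x)
  | ih2 a w ha hw =>
    have h : (FreeStarAlg.mono (FreeSemigroup.of a * w) 1 : E.PreAlg) =
        (FreeStarAlg.mono (FreeSemigroup.of a) 1 : E.PreAlg) * (FreeStarAlg.mono w 1 : E.PreAlg) := by
      refine Eq.trans ?_ (FreeStarAlg.mono_mul_mono _ _ _ _).symm
      simp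
    rw [h]
    exact (hp.mul_le _ _).trans (mul_le_one₀ ha (apply_nonneg p _) hw)

theorem exists_bound (x : E.PreAlg) : ∃ C : ℝ, ∀ p, E.IsCKSeminorm p → p x ≤ C := by
  induction x using FreeStarAlg.induction with
  | h0 => exact ⟨0, fun p _ => (map_zero p).le⟩
  | hadd x y hx hy =>
    obtain ⟨C, hC⟩ := hx
    obtain ⟨D, hD⟩ := hy
    exact ⟨C + D, fun p hp => (map_add_le_add p x y).trans (add_le_add (hC p hp) (hD p hp))⟩
  | hmono w c =>
    refine ⟨‖c‖, fun p hp => ?_⟩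
    have h : (FreeStarAlg.mono w c : E.PreAlg) = c • (FreeStarAlg.mono w 1 : E.PreAlg) := by
      refine Eq.trans ?_ (FreeStarAlg.smul_mono _ _ _).symm
      simp
    rw [h]
    refine (map_smul_eq_mul p c (FreeStarAlg.mono w 1 : FreeStarAlg _)).trans_le ?_
    exact mul_le_of_le_one_right (norm_nonneg c) (hp.word_le w)

end Seminorm

section Norm

variable (E : RowFiniteGraph)

/-- The largest C*-seminorm that vanishes on the relators. -/
def universalSeminorm : Seminorm ℂ E.PreAlg := sSup {p | E.IsCKSeminorm p}

theorem bddAbove_ckSeminorms : BddAbove {p | E.IsCKSeminorm p} := by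
  rw [Seminorm.bddAbove_iff]
  refine ⟨fun x => (exists_bound x).choose, ?_⟩
  rintro _ ⟨p, hp, rfl⟩ x
  exact (exists_bound x).choose_spec p hp

variable {E}

theorem le_universalSeminorm {p : Seminorm ℂ E.PreAlg} (hp : E.IsCKSeminorm p) (x : E.PreAlg) :
    p x ≤ E.universalSeminorm x :=
  le_csSup E.bddAbove_ckSeminorms hp x

theorem universalSeminorm_le {x : E.PreAlg} {C : ℝ} (hC : 0 ≤ C)
    (h : ∀ p, E.IsCKSeminorm p → p x ≤ C) : E.universalSeminorm x ≤ C := by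
  rw [universalSeminorm, Seminorm.sSup_apply E.bddAbove_ckSeminorms]
  exact Real.iSup_le (fun p => h p.1 p.2) hC

theorem isCKSeminorm_universalSeminorm : E.IsCKSeminorm E.universalSeminorm where
  mul_le x y := universalSeminorm_le (mul_nonneg (apply_nonneg _ _) (apply_nonneg _ _))
    fun p hp => (hp.mul_le x y).trans
      (mul_le_mul (le_universalSeminorm hp x) (le_universalSeminorm hp y) (apply_nonneg _ _)
        (apply_nonneg _ _))
  star_mul x := by
    refine le_antisymm (universalSeminorm_le (mul_nonneg (apply_nonneg _ _) (apply_nonneg _ _))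
      fun p hp => ?_) ?_
    · rw [hp.star_mul]
      exact mul_self_le_mul_self (apply_nonneg _ _) (le_universalSeminorm hp x)
    · have h : E.universalSeminorm x ≤ √(E.universalSeminorm (star x * x)) :=
        universalSeminorm_le (Real.sqrt_nonneg _) fun p hp => by
          refine Real.le_sqrt_of_sq_le ?_
          rw [sq, ← hp.star_mul]
          exact le_universalSeminorm hp _
      calc _ ≤ √(E.universalSeminorm (star x * x)) * √(E.universalSeminorm (star x * x)) :=
            mul_self_le_mul_self (apply_nonneg _ _) h
        _ = _ := Real.mul_self_sqrt (apply_nonneg _ _)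
  relator x hx := le_antisymm
    (universalSeminorm_le le_rfl fun p hp => (hp.relator x hx).le) (apply_nonneg _ _)

instance : SeminormedAddCommGroup E.PreAlg :=
  AddGroupSeminorm.toSeminormedAddCommGroup E.universalSeminorm.toAddGroupSeminorm

theorem norm_def (x : E.PreAlg) : ‖x‖ = E.universalSeminorm x := rfl

instance : NonUnitalSeminormedRing E.PreAlg where
  __ := (inferInstance : SeminormedAddCommGroup E.PreAlg)
  __ := (inferInstance : NonUnitalRing E.PreAlg)
  norm_mul_le := isCKSeminorm_universalSeminorm.mul_le

instance : NormedSpace ℂ E.PreAlg where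
  norm_smul_le c x := (map_smul_eq_mul E.universalSeminorm c x).le

instance : NormedStarGroup E.PreAlg where
  norm_star_le x := (isCKSeminorm_universalSeminorm.star_eq x).le

end Norm

/-- The graph C*-algebra `C*(E)`: the universal C*-algebra generated by a Cuntz--Krieger
`E`-family, i.e. the completion of the algebra of `*`-polynomials in `P v`, `S e` in the largest
C*-seminorm that vanishes on the relators. -/
def CStar (E : RowFiniteGraph) : Type := Completion E.PreAlg

section CStar

variable {E : RowFiniteGraph}

instance : NonUnitalCStarAlgebra E.CStar :=
  StarCompletion.cstarInst (A := E.PreAlg)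
    fun a => (isCKSeminorm_universalSeminorm.star_mul a).ge

/-- The canonical map of `*`-polynomials into `C*(E)`. -/
def of : E.PreAlg →⋆ₙₐ[ℂ] E.CStar where
  toFun x := (x : Completion E.PreAlg)
  map_smul' := Completion.coe_smul
  map_zero' := Completion.coe_zero
  map_add' := Completion.coe_add
  map_mul' := StarCompletion.coe_mul
  map_star' := StarCompletion.coe_star

theorem norm_of (x : E.PreAlg) : ‖(of x : E.CStar)‖ = E.universalSeminorm x :=
  Completion.norm_coe x

theorem denseRange_of : DenseRange (of : E.PreAlg → E.CStar) := Completion.denseRange_coe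

theorem of_relator {x y : E.PreAlg} (h : E.IsRelator (x - y)) : (of x : E.CStar) = of y := by
  rw [← sub_eq_zero, ← map_sub, ← norm_eq_zero, norm_of]
  exact isCKSeminorm_universalSeminorm.relator _ h

variable (E) in
/-- The canonical projections of `C*(E)`. -/
def P (v : E.Vert) : E.CStar := of (E.preP v)

variable (E) in
/-- The canonical partial isometries of `C*(E)`. -/
def S (e : E.Edge) : E.CStar := of (E.preS e)

variable (E) in
theorem isCuntzKrieger : E.IsCuntzKrieger E.P E.S where
  star_P v := by
    rw [P, ← map_star]
    exact of_relator (.star_P v)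
  P_mul_self v := by
    rw [P, ← map_mul]
    exact of_relator (.P_mul_self v)
  P_mul_P v w h := by
    rw [P, P, ← map_mul, ← map_zero (of : E.PreAlg →⋆ₙₐ[ℂ] E.CStar)]
    exact of_relator (by simpa using IsRelator.P_mul_P v w h)
  partial_isometry e := by
    rw [S, ← map_star, ← map_mul, ← map_mul]
    exact of_relator (.partial_isometry e)
  ck1 e := by
    rw [S, P, ← map_star, ← map_mul]
    exact of_relator (.ck1 e)
  ck2 v h := by
    simp only [S, P, ← map_star, ← map_mul, ← map_sum]
    exact of_relator (.ck2 v h)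

end CStar

section Lift

variable {E : RowFiniteGraph} {B : Type*} [NonUnitalCStarAlgebra B]
  {p : E.Vert → B} {s : E.Edge → B}

/-- The `*`-homomorphism on `*`-polynomials that is given by a pair of families. -/
def preLift (p : E.Vert → B) (s : E.Edge → B) : E.PreAlg →⋆ₙₐ[ℂ] B :=
  FreeStarAlg.lift (Sum.elim p s)

theorem preLift_preP (p : E.Vert → B) (s : E.Edge → B) (v : E.Vert) :
    preLift p s (E.preP v) = p v := FreeStarAlg.lift_gen (Sum.elim p s) (Sum.inl v)

theorem preLift_preS (p : E.Vert → B) (s : E.Edge → B) (e : E.Edge) :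
    preLift p s (E.preS e) = s e := FreeStarAlg.lift_gen (Sum.elim p s) (Sum.inr e)

/-- The C*-seminorm of a Cuntz--Krieger family. -/
def liftSeminorm (p : E.Vert → B) (s : E.Edge → B) : Seminorm ℂ E.PreAlg :=
  Seminorm.of (fun x => ‖preLift p s x‖) (fun x y => by rw [map_add]; exact norm_add_le _ _)
    (fun c x => by rw [map_smul, norm_smul])

theorem isCKSeminorm_liftSeminorm (h : E.IsCuntzKrieger p s) :
    E.IsCKSeminorm (liftSeminorm p s) where
  mul_le x y := by
    change ‖preLift p s (x * y)‖ ≤ ‖preLift p s x‖ * ‖preLift p s y‖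
    rw [map_mul]
    exact norm_mul_le _ _
  star_mul x := by
    change ‖preLift p s (star x * x)‖ = ‖preLift p s x‖ * ‖preLift p s x‖
    rw [map_mul, map_star, CStarRing.norm_star_mul_self]
  relator x hx := by
    change ‖preLift p s x‖ = 0
    rw [norm_eq_zero]
    cases hx with
    | star_P v => simp [map_star, preLift_preP, h.star_P]
    | P_mul_self v => simp [preLift_preP, h.P_mul_self]
    | P_mul_P v w hvw => simp [preLift_preP, h.P_mul_P v w hvw]
    | partial_isometry e => simp [map_star, preLift_preS, h.partial_isometry]
    | ck1 e => simp [map_star, preLift_preS, preLift_preP, h.ck1]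
    | ck2 v hv => simp [map_star, preLift_preS, preLift_preP, h.ck2 v hv]

theorem norm_preLift_le (h : E.IsCuntzKrieger p s) (x : E.PreAlg) : ‖preLift p s x‖ ≤ ‖x‖ :=
  le_universalSeminorm (isCKSeminorm_liftSeminorm h) x

theorem continuous_preLift (h : E.IsCuntzKrieger p s) : UniformContinuous (preLift p s) :=
  (AddMonoidHomClass.lipschitz_of_bound (preLift p s) 1
    (by simpa using norm_preLift_le h)).uniformContinuous

/-- The continuous extension of `preLift`. -/
def liftFun (p : E.Vert → B) (s : E.Edge → B) : E.CStar → B :=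
  Completion.extension (preLift p s)

theorem liftFun_of (h : E.IsCuntzKrieger p s) (x : E.PreAlg) :
    liftFun p s (of x) = preLift p s x :=
  Completion.extension_coe (continuous_preLift h) x

theorem continuous_liftFun (p : E.Vert → B) (s : E.Edge → B) : Continuous (liftFun p s) :=
  Completion.continuous_extension

/-- The universal property of `C*(E)`: a Cuntz--Krieger `E`-family in a C*-algebra determines a
`*`-homomorphism. -/
def lift (p : E.Vert → B) (s : E.Edge → B) (h : E.IsCuntzKrieger p s) : E.CStar →⋆ₙₐ[ℂ] B where
  toFun := liftFun p s
  map_smul' c x := by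
    induction x using denseRange_of.induction_on with
    | hp =>
      exact isClosed_eq ((continuous_liftFun p s).comp (continuous_const_smul c))
        ((continuous_liftFun p s).const_smul c)
    | ih a => rw [← map_smul, liftFun_of h, liftFun_of h, map_smul, MonoidHom.id_apply]
  map_zero' := by
    rw [← map_zero (of : E.PreAlg →⋆ₙₐ[ℂ] E.CStar), liftFun_of h, map_zero]
  map_add' x y := by
    induction x, y using denseRange_of.induction_on₂ with
    | hp =>
      exact isClosed_eq ((continuous_liftFun p s).comp continuous_add)
        (((continuous_liftFun p s).comp continuous_fst).add
          ((continuous_liftFun p s).comp continuous_snd))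
    | h a b => rw [← map_add, liftFun_of h, liftFun_of h, liftFun_of h, map_add]
  map_mul' x y := by
    induction x, y using denseRange_of.induction_on₂ with
    | hp =>
      exact isClosed_eq ((continuous_liftFun p s).comp continuous_mul)
        (((continuous_liftFun p s).comp continuous_fst).mul
          ((continuous_liftFun p s).comp continuous_snd))
    | h a b => rw [← map_mul, liftFun_of h, liftFun_of h, liftFun_of h, map_mul]
  map_star' x := by
    induction x using denseRange_of.induction_on with
    | hp =>
      exact isClosed_eq ((continuous_liftFun p s).comp continuous_star)
        (continuous_liftFun p s).star
    | ih a => rw [← map_star, liftFun_of h, liftFun_of h, map_star]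

theorem lift_of (h : E.IsCuntzKrieger p s) (x : E.PreAlg) : lift p s h (of x) = preLift p s x :=
  liftFun_of h x

@[simp] theorem lift_P (h : E.IsCuntzKrieger p s) (v : E.Vert) : lift p s h (E.P v) = p v := by
  rw [P, lift_of, preLift_preP]

@[simp] theorem lift_S (h : E.IsCuntzKrieger p s) (e : E.Edge) : lift p s h (E.S e) = s e := by
  rw [S, lift_of, preLift_preS]

end Lift

end RowFiniteGraph

namespace RowFiniteGraph

open GraphCStar

/-! ### Gauge action, quotient graphs and ideals of vertex projections -/

section Gauge

variable (E : RowFiniteGraph)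

theorem isCuntzKrieger_gauge (z : Circle) :
    E.IsCuntzKrieger E.P (fun e => (z : ℂ) • E.S e) := by
  have h := E.isCuntzKrieger
  have hz : star (z : ℂ) * z = 1 := by
    rw [← starRingEnd_apply, ← Circle.coe_inv_eq_conj, ← Circle.coe_mul, inv_mul_cancel,
      Circle.coe_one]
  have hz' : (z : ℂ) * star (z : ℂ) = 1 := by rw [mul_comm, hz]
  refine ⟨h.star_P, h.P_mul_self, h.P_mul_P, fun e => ?_, fun e => ?_, fun v hv => ?_⟩
  · rw [star_smul, smul_mul_smul_comm, hz', one_smul, mul_smul_comm, h.partial_isometry]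
  · rw [star_smul, smul_mul_smul_comm, hz, one_smul, h.ck1]
  · simp only [star_smul, smul_mul_smul_comm, hz', one_smul]
    exact h.ck2 v hv

/-- The gauge action of `U(1)` on `C*(E)`: `P v ↦ P v`, `S e ↦ z S e`. -/
def gauge (z : Circle) : E.CStar →⋆ₙₐ[ℂ] E.CStar :=
  lift E.P (fun e => (z : ℂ) • E.S e) (E.isCuntzKrieger_gauge z)

end Gauge

/-- There is a path (possibly of length zero) from `v` to `w`. -/
def Reachable (E : RowFiniteGraph) : E.Vert → E.Vert → Prop :=
  Relation.ReflTransGen fun v w => ∃ e, E.src e = v ∧ E.rng e = w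

/-- Saturated hereditary sets of vertices. -/
structure SatHereditary (E : RowFiniteGraph) where
  /-- the underlying set -/
  carrier : Set E.Vert
  hereditary : ∀ v w, E.Reachable v w → v ∈ carrier → w ∈ carrier
  saturated : ∀ v, ¬ E.IsSink v → (∀ e, E.src e = v → E.rng e ∈ carrier) → v ∈ carrier

theorem hereditary_of_edge {E : RowFiniteGraph} {H : Set E.Vert}
    (h : ∀ e, E.src e ∈ H → E.rng e ∈ H) (v w : E.Vert) (hvw : E.Reachable v w) (hv : v ∈ H) :
    w ∈ H := by
  induction hvw with
  | refl => exact hv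
  | tail _ he ih =>
    obtain ⟨e, rfl, rfl⟩ := he
    exact h e ih

theorem SatHereditary.src_notMem {E : RowFiniteGraph} (H : E.SatHereditary) {e : E.Edge}
    (he : E.rng e ∉ H.carrier) : E.src e ∉ H.carrier :=
  fun h => he (H.hereditary _ _ (.single ⟨e, rfl, rfl⟩) h)

/-- The quotient graph `E / H`: remove the vertices in `H` and the edges with range in `H`. -/
def quotient (E : RowFiniteGraph) (H : E.SatHereditary) : RowFiniteGraph where
  Vert := {v : E.Vert // v ∉ H.carrier}
  Edge := {e : E.Edge // E.rng e ∉ H.carrier}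
  src e := ⟨E.src e, H.src_notMem e.2⟩
  rng e := ⟨E.rng e, e.2⟩
  finite_out v := by
    refine Set.Finite.of_finite_image (f := Subtype.val) ((E.finite_out v.1).subset ?_)
      Subtype.val_injective.injOn
    rintro _ ⟨e, rfl, rfl⟩
    rfl

section QuotientMap

variable {E : RowFiniteGraph} (H : E.SatHereditary)

open Classical in
/-- `P v` for `v ∉ H`, and `0` for `v ∈ H`. -/
def quotP (v : E.Vert) : (E.quotient H).CStar :=
  if h : v ∉ H.carrier then (E.quotient H).P ⟨v, h⟩ else 0

open Classical in
/-- `S e` if the range of `e` is not in `H`, and `0` otherwise. -/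
def quotS (e : E.Edge) : (E.quotient H).CStar :=
  if h : E.rng e ∉ H.carrier then (E.quotient H).S ⟨e, h⟩ else 0

theorem isCuntzKrieger_quot : E.IsCuntzKrieger (quotP H) (quotS H) := by
  have hF := (E.quotient H).isCuntzKrieger
  refine ⟨fun v => ?_, fun v => ?_, fun v w hvw => ?_, fun e => ?_, fun e => ?_, fun v hv => ?_⟩
  · unfold quotP
    split_ifs
    · exact star_zero _
    · exact hF.star_P _
  · unfold quotP
    split_ifs
    · exact mul_zero _
    · exact hF.P_mul_self _
  · unfold quotP
    split_ifs
    · exact mul_zero _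
    · exact zero_mul _
    · exact mul_zero _
    · exact hF.P_mul_P _ _ fun h => hvw (congrArg Subtype.val h)
  · unfold quotS
    split_ifs
    · exact mul_zero _
    · exact hF.partial_isometry _
  · unfold quotS quotP
    split_ifs
    · exact mul_zero _
    · exact hF.ck1 _
  · by_cases hvH : v ∈ H.carrier
    · have hP : quotP H v = 0 := dif_neg (not_not.2 hvH)
      rw [hP]
      refine Finset.sum_eq_zero fun e he => ?_
      have hS : quotS H e = 0 := dif_neg (not_not.2 (H.hereditary v _
        (.single ⟨e, mem_out.1 he, rfl⟩) hvH))
      rw [hS, zero_mul]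
    · have hP : quotP H v = (E.quotient H).P ⟨v, hvH⟩ := dif_pos hvH
      have hns : ¬ (E.quotient H).IsSink ⟨v, hvH⟩ := by
        intro hs
        refine hvH (H.saturated v hv fun e he => ?_)
        by_contra hr
        exact hs ⟨e, hr⟩ (Subtype.ext he)
      rw [hP, ← hF.ck2 _ hns]
      symm
      refine Finset.sum_of_injOn Subtype.val Subtype.val_injective.injOn ?_ ?_ ?_
      · intro e he
        exact mem_out.2 (congrArg Subtype.val (mem_out.1 he))
      · intro e he hne
        have hS : quotS H e = 0 := by
          refine dif_neg fun hr => hne ⟨⟨e, hr⟩, ?_, rfl⟩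
          exact mem_out.2 (Subtype.ext (mem_out.1 he))
        rw [hS, zero_mul]
      · intro e _
        have hS : quotS H e.1 = (E.quotient H).S e := dif_pos e.2
        rw [hS]

/-- The canonical map `C*(E) → C*(E / H)`, which kills the generators that belong to removed
vertices and edges and fixes the others. -/
def quotientMap : E.CStar →⋆ₙₐ[ℂ] (E.quotient H).CStar :=
  lift (quotP H) (quotS H) (isCuntzKrieger_quot H)

end QuotientMap

/-- The closed two-sided ideal of `C*(E)` that is generated by the projections `P v`, `v ∈ H`. -/
def closedIdeal (E : RowFiniteGraph) (H : Set E.Vert) : Set E.CStar :=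
  closure (TwoSidedIdeal.span (E.P '' H) : Set E.CStar)

/-- Isomorphisms of graphs. -/
structure Iso (E F : RowFiniteGraph) where
  /-- the bijection of vertices -/
  vert : E.Vert ≃ F.Vert
  /-- the bijection of edges -/
  edge : E.Edge ≃ F.Edge
  src_edge : ∀ e, F.src (edge e) = vert (E.src e)
  rng_edge : ∀ e, F.rng (edge e) = vert (E.rng e)

/-- The inverse of an isomorphism of graphs. -/
def Iso.symm {E F : RowFiniteGraph} (i : Iso E F) : Iso F E where
  vert := i.vert.symm
  edge := i.edge.symm
  src_edge e := by rw [← Equiv.symm_apply_apply i.vert (E.src _), ← i.src_edge]; simp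
  rng_edge e := by rw [← Equiv.symm_apply_apply i.vert (E.rng _), ← i.rng_edge]; simp

theorem isCuntzKrieger_iso {E F : RowFiniteGraph} (i : Iso E F) :
    E.IsCuntzKrieger (fun v => F.P (i.vert v)) (fun e => F.S (i.edge e)) := by
  have hF := F.isCuntzKrieger
  refine ⟨fun v => hF.star_P _, fun v => hF.P_mul_self _,
    fun v w h => hF.P_mul_P _ _ fun h' => h (i.vert.injective h'),
    fun e => hF.partial_isometry _, fun e => ?_, fun v hv => ?_⟩
  · rw [← i.rng_edge]
    exact hF.ck1 _
  · have hns : ¬ F.IsSink (i.vert v) := fun hs => hv fun e he => hs (i.edge e) (by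
      rw [i.src_edge, he])
    rw [← hF.ck2 _ hns]
    refine Finset.sum_equiv i.edge (fun e => ?_) fun e _ => rfl
    rw [mem_out, mem_out, i.src_edge, i.vert.injective.eq_iff]

/-- The `*`-homomorphism `C*(E) → C*(F)` induced by an isomorphism of graphs. -/
def Iso.map {E F : RowFiniteGraph} (i : Iso E F) : E.CStar →⋆ₙₐ[ℂ] F.CStar :=
  lift (fun v => F.P (i.vert v)) (fun e => F.S (i.edge e)) (isCuntzKrieger_iso i)

/-- The subgraph with the same vertices and with one edge removed. -/
def removeEdge (E : RowFiniteGraph) (e₀ : E.Edge) : RowFiniteGraph where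
  Vert := E.Vert
  Edge := {e : E.Edge // e ≠ e₀}
  src e := E.src e
  rng e := E.rng e
  finite_out v := Set.Finite.of_finite_image (f := Subtype.val)
    ((E.finite_out v).subset (by rintro _ ⟨e, rfl, rfl⟩; rfl)) Subtype.val_injective.injOn

end RowFiniteGraph

/-! ### The graphs of the quantum lens spaces -/

namespace LensGraph

open RowFiniteGraph

/-- The vertices `v⁰₀, v¹₀, …, v¹_{l-1}` of `L³_l`. -/
inductive LensVertex (l : ℕ) : Type
  | v0 : LensVertex l
  | v1 (i : Fin l) : LensVertex l

/-- The edges of `L³_l`: the loop `e⁰₀` over `v⁰₀`, the edges `e⁰¹_i` from `v⁰₀` to `v¹_i`, and the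
loops `e¹_i` over `v¹_i`. -/
inductive LensEdge (l : ℕ) : Type
  | e0 : LensEdge l
  | e01 (i : Fin l) : LensEdge l
  | e1 (i : Fin l) : LensEdge l

theorem finite_lensEdge (l : ℕ) : Finite (LensEdge l) := by
  let f : Option (Fin l ⊕ Fin l) → LensEdge l
    | none => .e0
    | some (Sum.inl i) => .e01 i
    | some (Sum.inr i) => .e1 i
  refine Finite.of_surjective f ?_
  rintro (_ | i | i)
  · exact ⟨none, rfl⟩
  · exact ⟨some (Sum.inl i), rfl⟩
  · exact ⟨some (Sum.inr i), rfl⟩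

/-- The source map of `L³_l`. -/
def lensSrc {l : ℕ} : LensEdge l → LensVertex l
  | .e0 => .v0
  | .e01 _ => .v0
  | .e1 i => .v1 i

/-- The range map of `L³_l`. -/
def lensRng {l : ℕ} : LensEdge l → LensVertex l
  | .e0 => .v0
  | .e01 i => .v1 i
  | .e1 i => .v1 i

/-- The graph `L³_l` of the quantum lens space `L³_q(l; 1, l)`. For `l = 0` it is a single vertex
with a loop. -/
def L3 (l : ℕ) : RowFiniteGraph where
  Vert := LensVertex l
  Edge := LensEdge l
  src := lensSrc
  rng := lensRng
  finite_out _ := by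
    have := finite_lensEdge l
    exact Set.toFinite _

/-- The graph `Q_l` for `l = k + 1`: the graph `L³_l` without the loop `e¹_{l-1}`. -/
def Q (k : ℕ) : RowFiniteGraph := (L3 (k + 1)).removeEdge (LensEdge.e1 (Fin.last k))

/-- The loop `e⁰₀` of `Q_l`. -/
def Q.e0 (k : ℕ) : (Q k).Edge := ⟨LensEdge.e0, nofun⟩

/-- The edge `e⁰¹_i` of `Q_l`. -/
def Q.e01 {k : ℕ} (i : Fin (k + 1)) : (Q k).Edge := ⟨LensEdge.e01 i, nofun⟩

/-- The saturated hereditary set `{v¹_{l-1}}` of vertices of `Q_l`, `l = k + 1`. -/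
def lastVertex (k : ℕ) : (Q k).SatHereditary where
  carrier := {LensVertex.v1 (Fin.last k)}
  hereditary := hereditary_of_edge fun e he => by
    obtain ⟨(_ | i | i), hi⟩ := e
    · exact absurd he nofun
    · exact absurd he nofun
    · exact he
  saturated v hv h := by
    rcases v with _ | i
    · exact absurd (h (Q.e0 k) rfl) nofun
    · by_contra hi
      have hne : LensEdge.e1 i ≠ LensEdge.e1 (Fin.last k) := fun h' => hi (by
        rw [LensEdge.e1.inj h']; rfl)
      exact hi (h ⟨LensEdge.e1 i, hne⟩ rfl)

/-- The saturated hereditary set `H = {v¹_0, …, v¹_{l-2}}` of vertices of `Q_l`, `l = k + 1`. -/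
def H (k : ℕ) : (Q k).SatHereditary where
  carrier := {v | ∃ i : Fin k, v = LensVertex.v1 i.castSucc}
  hereditary := hereditary_of_edge fun e he => by
    obtain ⟨(_ | i | i), hi⟩ := e
    · exact he
    · obtain ⟨j, hj⟩ := he
      exact absurd hj nofun
    · exact he
  saturated v hv h := by
    rcases v with _ | i
    · obtain ⟨j, hj⟩ := h (Q.e0 k) rfl
      exact absurd hj nofun
    · obtain ⟨⟨e, he⟩, hs⟩ : ∃ e, (Q k).src e = LensVertex.v1 i := by
        by_contra hc
        exact hv fun e he => hc ⟨e, he⟩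
      rcases e with _ | j | j
      · exact absurd hs nofun
      · exact absurd hs nofun
      · have hji : j = i := LensVertex.v1.inj hs
        subst hji
        exact h ⟨LensEdge.e1 j, he⟩ rfl

/-- The set `{v¹_0, …, v¹_{k-1}}` as a saturated hereditary set of vertices of `L³_k`. -/
def HL (k : ℕ) : (L3 k).SatHereditary where
  carrier := {v | ∃ i : Fin k, v = LensVertex.v1 i}
  hereditary := hereditary_of_edge fun e he => by
    rcases e with _ | i | i
    · exact he
    · exact ⟨i, rfl⟩
    · exact he
  saturated v hv h := by
    rcases v with _ | i
    · obtain ⟨j, hj⟩ := h LensEdge.e0 rfl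
      exact absurd hj nofun
    · exact ⟨i, rfl⟩

/-- The identification of the vertices of `L³_k` with those of `Q_{k+1} / {v¹_k}`. -/
def isoVert (k : ℕ) : (L3 k).Vert → ((Q k).quotient (lastVertex k)).Vert
  | .v0 => ⟨LensVertex.v0, nofun⟩
  | .v1 i => ⟨LensVertex.v1 i.castSucc, fun h =>
      (Fin.castSucc_lt_last i).ne (LensVertex.v1.inj h)⟩

/-- The identification of the edges of `L³_k` with those of `Q_{k+1} / {v¹_k}`. -/
def isoEdge (k : ℕ) : (L3 k).Edge → ((Q k).quotient (lastVertex k)).Edge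
  | .e0 => ⟨Q.e0 k, nofun⟩
  | .e01 i => ⟨Q.e01 i.castSucc, fun h => (Fin.castSucc_lt_last i).ne (LensVertex.v1.inj h)⟩
  | .e1 i => ⟨⟨LensEdge.e1 i.castSucc, fun h =>
      (Fin.castSucc_lt_last i).ne (LensEdge.e1.inj h)⟩, fun h =>
      (Fin.castSucc_lt_last i).ne (LensVertex.v1.inj h)⟩

theorem bijective_isoVert (k : ℕ) : Function.Bijective (isoVert k) := by
  constructor
  · rintro (_ | i) (_ | j) h
    · rfl
    · exact absurd (congrArg Subtype.val h) nofun
    · exact absurd (congrArg Subtype.val h) nofun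
    · rw [Fin.castSucc_injective k (LensVertex.v1.inj (congrArg Subtype.val h))]
  · rintro ⟨_ | i, hi⟩
    · exact ⟨.v0, rfl⟩
    · have hne : i ≠ Fin.last k := fun h => hi (by rw [h]; rfl)
      obtain ⟨j, rfl⟩ := Fin.exists_castSucc_eq.2 hne
      exact ⟨.v1 j, rfl⟩

theorem bijective_isoEdge (k : ℕ) : Function.Bijective (isoEdge k) := by
  constructor
  · intro e f h
    have h' := congrArg (fun x => x.1.1) h
    rcases e with _ | i | i <;> rcases f with _ | j | j
    · rfl
    · exact absurd h' nofun
    · exact absurd h' nofun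
    · exact absurd h' nofun
    · rw [Fin.castSucc_injective k (LensEdge.e01.inj h')]
    · exact absurd h' nofun
    · exact absurd h' nofun
    · exact absurd h' nofun
    · rw [Fin.castSucc_injective k (LensEdge.e1.inj h')]
  · rintro ⟨⟨_ | i | i, hi⟩, hr⟩
    · exact ⟨.e0, rfl⟩
    · have hne : i ≠ Fin.last k := fun h => hr (congrArg LensVertex.v1 h)
      obtain ⟨j, rfl⟩ := Fin.exists_castSucc_eq.2 hne
      exact ⟨.e01 j, rfl⟩
    · have hne : i ≠ Fin.last k := fun h => hr (congrArg LensVertex.v1 h)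
      obtain ⟨j, rfl⟩ := Fin.exists_castSucc_eq.2 hne
      exact ⟨.e1 j, rfl⟩

/-- `L³_{l-1} ≅ Q_l / {v¹_{l-1}}`, where `l = k + 1`. -/
def lensIso (k : ℕ) : Iso (L3 k) ((Q k).quotient (lastVertex k)) where
  vert := Equiv.ofBijective (isoVert k) (bijective_isoVert k)
  edge := Equiv.ofBijective (isoEdge k) (bijective_isoEdge k)
  src_edge e := by rcases e with _ | i | i <;> rfl
  rng_edge e := by rcases e with _ | i | i <;> rfl

/-- The map `χ₁ : C*(Q_l) → C*(Q_l / {v¹_{l-1}}) = C*(L³_{l-1})`, where `l = k + 1`. -/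
def chi1 (k : ℕ) : (Q k).CStar →⋆ₙₐ[ℂ] (L3 k).CStar :=
  (lensIso k).symm.map.comp (quotientMap (lastVertex k))

/-- The loop of the graph `Q_l / H`. -/
def QH.e0 (k : ℕ) : ((Q k).quotient (H k)).Edge := ⟨Q.e0 k, fun ⟨_, hi⟩ => nomatch hi⟩

/-- The edge `e⁰¹_{l-1}` of the graph `Q_l / H`, where `l = k + 1`. -/
def QH.e01 (k : ℕ) : ((Q k).quotient (H k)).Edge :=
  ⟨Q.e01 (Fin.last k), fun ⟨i, hi⟩ => (Fin.castSucc_lt_last i).ne (LensVertex.v1.inj hi).symm⟩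

/-- The loop of the graph `L³_{l-1} / H`, where `l = k + 1`. -/
def LH.e0 (k : ℕ) : ((L3 k).quotient (HL k)).Edge := ⟨LensEdge.e0, fun ⟨_, hi⟩ => nomatch hi⟩

end LensGraph

/-! ### The Toeplitz algebra and its symbol map -/

namespace Toeplitz

open Filter Topology

/-- The Hilbert space `ℓ²(ℕ)`. -/
abbrev L2 : Type := lp (fun _ : ℕ => ℂ) 2

/-- The sequence `0, x 0, x 1, …`. -/
def shiftSeq (x : ℕ → ℂ) : ℕ → ℂ
  | 0 => 0
  | n + 1 => x n

theorem memlp_shiftSeq (x : L2) : Memℓp (shiftSeq x) 2 := by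
  have h := lp.memℓp x
  rw [memℓp_gen_iff (by norm_num)] at h ⊢
  rw [← summable_nat_add_iff 1]
  exact h

/-- The unilateral shift on `ℓ²(ℕ)` as a linear isometry. -/
def shiftIsometry : L2 →ₗᵢ[ℂ] L2 where
  toFun x := ⟨shiftSeq x, memlp_shiftSeq x⟩
  map_add' x y := by
    ext n
    change shiftSeq (x + y : L2) n = shiftSeq x n + shiftSeq y n
    cases n <;> simp [shiftSeq]
  map_smul' c x := by
    ext n
    change shiftSeq (c • x : L2) n = c • shiftSeq x n
    cases n <;> simp [shiftSeq]
  norm_map' x := by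
    have h2 : (0 : ℝ) < (2 : ENNReal).toReal := by norm_num
    rw [← Real.rpow_left_inj (norm_nonneg _) (norm_nonneg _) h2.ne', lp.norm_rpow_eq_tsum h2,
      lp.norm_rpow_eq_tsum h2]
    have hs : Summable fun n => ‖shiftSeq x n‖ ^ (2 : ENNReal).toReal :=
      (memℓp_gen_iff h2).1 (memlp_shiftSeq x)
    change ∑' n, ‖shiftSeq x n‖ ^ (2 : ENNReal).toReal = _
    rw [hs.tsum_eq_zero_add]
    simp [shiftSeq]

/-- The unilateral shift on `ℓ²(ℕ)`. -/
def shift : L2 →L[ℂ] L2 := shiftIsometry.toContinuousLinearMap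

/-- The Toeplitz algebra: the unital C*-algebra of operators on `ℓ²(ℕ)` that is generated by the
unilateral shift. -/
abbrev ToeplitzAlgebra : Type := StarAlgebra.elemental ℂ shift

/-- The isometry that generates the Toeplitz algebra. -/
def s : ToeplitzAlgebra := ⟨shift, StarAlgebra.elemental.self_mem ℂ shift⟩

theorem star_shift_mul_shift : star shift * shift = 1 := by
  rw [ContinuousLinearMap.star_eq_adjoint]
  exact (ContinuousLinearMap.norm_map_iff_adjoint_comp_self shift).1 shiftIsometry.norm_map

/-- The standard unitary generator of `C(S¹)`: the inclusion of the unit circle `S¹` into `ℂ`. -/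
def u : C(Circle, ℂ) := ⟨fun z => (z : ℂ), by fun_prop⟩

/-! The symbol map is constructed from approximate eigenvectors of the shift. -/

/-- The `k`-th vector of the standard basis of `ℓ²(ℕ)`. -/
def basisVec (k : ℕ) : L2 := lp.single 2 k (1 : ℂ)

theorem shift_basisVec (k : ℕ) : shift (basisVec k) = basisVec (k + 1) := by
  ext n
  change shiftSeq (basisVec k) n = _
  cases n with
  | zero => simp [shiftSeq, basisVec, lp.single_apply]
  | succ n => simp [shiftSeq, basisVec, lp.single_apply, Pi.single_apply]

theorem norm_basisVec (k : ℕ) : ‖basisVec k‖ = 1 := by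
  simp [basisVec, lp.norm_single]

theorem orthonormal_basisVec : Orthonormal ℂ basisVec := by
  refine ⟨norm_basisVec, fun i j hij => ?_⟩
  have h := lp.inner_single_left (𝕜 := ℂ) i (1 : ℂ) (basisVec j)
  refine h.trans ?_
  simp [basisVec, lp.single_apply, hij]

/-- The vector `∑ k < n + 1, z⁻ᵏ e_k`. -/
def eigSum (z : Circle) (n : ℕ) : L2 :=
  ∑ k ∈ Finset.range (n + 1), ((z⁻¹ ^ k : Circle) : ℂ) • basisVec k

theorem norm_eigSum (z : Circle) (n : ℕ) : ‖eigSum z n‖ = √(n + 1) := by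
  rw [eq_comm, Real.sqrt_eq_iff_mul_self_eq (by positivity) (norm_nonneg _)]
  have h := orthonormal_basisVec.inner_sum (fun k => ((z⁻¹ ^ k : Circle) : ℂ))
    (fun k => ((z⁻¹ ^ k : Circle) : ℂ)) (Finset.range (n + 1))
  change inner ℂ (eigSum z n) (eigSum z n) = _ at h
  rw [inner_self_eq_norm_sq_to_K] at h
  have h1 (k : ℕ) : (starRingEnd ℂ) ((z⁻¹ ^ k : Circle) : ℂ) * ((z⁻¹ ^ k : Circle) : ℂ) = 1 := by
    rw [← Circle.coe_inv_eq_conj, ← Circle.coe_mul, inv_mul_cancel, Circle.coe_one]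
  simp only [h1, Finset.sum_const, Finset.card_range, nsmul_eq_mul, mul_one] at h
  rw [← sq]
  refine Complex.ofReal_injective ?_
  push_cast at h ⊢
  exact h.symm

theorem shift_eigSum (z : Circle) (n : ℕ) :
    ‖shift (eigSum z n) - (z : ℂ) • eigSum z n‖ ≤ 2 := by
  have h : shift (eigSum z n) - (z : ℂ) • eigSum z n =
      ((z⁻¹ ^ n : Circle) : ℂ) • basisVec (n + 1) - (z : ℂ) • basisVec 0 := by
    induction n with
    | zero => simp [eigSum, shift_basisVec]
    | succ n ih =>
      have h1 : eigSum z (n + 1) = eigSum z n + ((z⁻¹ ^ (n + 1) : Circle) : ℂ) • basisVec (n + 1) :=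
        Finset.sum_range_succ _ _
      have h2 : (z : ℂ) * ((z⁻¹ ^ (n + 1) : Circle) : ℂ) = ((z⁻¹ ^ n : Circle) : ℂ) := by
        rw [← Circle.coe_mul, pow_succ]
        simp
      rw [h1, map_add, map_smul, shift_basisVec, smul_add, smul_smul, h2]
      rw [add_sub_add_comm, ih]
      abel
  rw [h]
  refine (norm_sub_le _ _).trans ?_
  rw [norm_smul, norm_smul, norm_basisVec, norm_basisVec, Circle.norm_coe, Circle.norm_coe]
  norm_num

/-- Unit vectors that are asymptotically eigenvectors of the shift for the eigenvalue `z`. -/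
def eig (z : Circle) (n : ℕ) : L2 := ((√(n + 1))⁻¹ : ℂ) • eigSum z n

theorem norm_eig (z : Circle) (n : ℕ) : ‖eig z n‖ = 1 := by
  have : √((n : ℝ) + 1) ≠ 0 := by positivity
  rw [eig, norm_smul, norm_eigSum, norm_inv, Complex.norm_real, Real.norm_of_nonneg (by positivity)]
  exact inv_mul_cancel₀ this

theorem norm_shift_eig_le (z : Circle) (n : ℕ) :
    ‖shift (eig z n) - (z : ℂ) • eig z n‖ ≤ (√(n + 1))⁻¹ * 2 := by
  rw [eig, map_smul, smul_comm, ← smul_sub, norm_smul, norm_inv, Complex.norm_real,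
    Real.norm_of_nonneg (by positivity)]
  exact mul_le_mul_of_nonneg_left (shift_eigSum z n) (by positivity)

theorem tendsto_shift_eig (z : Circle) :
    Tendsto (fun n => shift (eig z n) - (z : ℂ) • eig z n) atTop (𝓝 0) := by
  refine squeeze_zero_norm (norm_shift_eig_le z) ?_
  rw [← zero_mul (2 : ℝ)]
  refine Tendsto.mul_const _ (tendsto_inv_atTop_zero.comp (Real.tendsto_sqrt_atTop.comp ?_))
  exact tendsto_atTop_add_const_right _ _ tendsto_natCast_atTop_atTop

theorem tendsto_star_shift_eig (z : Circle) :
    Tendsto (fun n => (star shift) (eig z n) - star (z : ℂ) • eig z n) atTop (𝓝 0) := by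
  have h : (fun n => (star shift) (eig z n) - star (z : ℂ) • eig z n) = fun n =>
      -(star (z : ℂ) • (star shift) (shift (eig z n) - (z : ℂ) • eig z n)) := by
    funext n
    have h1 : (star shift) (shift (eig z n)) = eig z n :=
      congrArg (fun x : L2 →L[ℂ] L2 => x (eig z n)) star_shift_mul_shift
    have h2 : star (z : ℂ) * z = 1 := by
      have := Circle.coe_inv_eq_conj z
      rw [← starRingEnd_apply, ← this, ← Circle.coe_mul, inv_mul_cancel, Circle.coe_one]
    rw [map_sub, map_smul, h1, smul_sub, smul_smul, h2, one_smul, neg_sub]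
  rw [h]
  have h1 : Tendsto (fun n => (star shift) (shift (eig z n) - (z : ℂ) • eig z n)) atTop (𝓝 0) := by
    have := ((star shift).continuous.tendsto 0).comp (tendsto_shift_eig z)
    rwa [map_zero] at this
  have h2 := (h1.const_smul (star (z : ℂ))).neg
  rwa [smul_zero, neg_zero] at h2

/-- `η` is asymptotically an eigenvector of `x` with eigenvalue `c`. -/
def IsAsympEig (η : ℕ → L2) (x : L2 →L[ℂ] L2) (c : ℂ) : Prop :=
  Tendsto (fun n => x (η n) - c • η n) atTop (𝓝 0)

theorem IsAsympEig.add {η : ℕ → L2} {x y : L2 →L[ℂ] L2} {c d : ℂ} (hx : IsAsympEig η x c)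
    (hy : IsAsympEig η y d) : IsAsympEig η (x + y) (c + d) := by
  have h := Tendsto.add hx hy
  rw [add_zero] at h
  refine h.congr fun n => ?_
  rw [_root_.add_apply, add_smul]
  abel

theorem IsAsympEig.mul {η : ℕ → L2} {x y : L2 →L[ℂ] L2} {c d : ℂ} (hx : IsAsympEig η x c)
    (hy : IsAsympEig η y d) : IsAsympEig η (x * y) (c * d) := by
  have h1 : Tendsto (fun n => x (y (η n) - d • η n)) atTop (𝓝 0) := by
    have := (x.continuous.tendsto 0).comp hy
    rwa [map_zero] at this
  have h := h1.add (Tendsto.const_smul hx d)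
  rw [smul_zero, add_zero] at h
  refine h.congr fun n => ?_
  rw [mul_apply_eq_comp, map_sub, map_smul, smul_sub, smul_smul, mul_comm d c]
  abel

theorem isAsympEig_algebraMap (η : ℕ → L2) (c : ℂ) : IsAsympEig η (algebraMap ℂ _ c) c := by
  refine tendsto_const_nhds.congr fun n => ?_
  rw [Algebra.algebraMap_eq_smul_one]
  simp

theorem IsAsympEig.norm_le {η : ℕ → L2} (hη : ∀ n, ‖η n‖ = 1) {x : L2 →L[ℂ] L2} {c : ℂ}
    (hx : IsAsympEig η x c) : ‖c‖ ≤ ‖x‖ := by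
  have h : Tendsto (fun n => ‖x (η n) - c • η n‖ + ‖x‖) atTop (𝓝 (‖(0 : L2)‖ + ‖x‖)) :=
    (Tendsto.norm hx).add_const _
  rw [norm_zero, zero_add] at h
  refine ge_of_tendsto' h fun n => ?_
  have h1 : ‖c‖ = ‖c • η n‖ := by rw [norm_smul, hη, mul_one]
  have h2 : ‖x (η n)‖ ≤ ‖x‖ := by simpa [hη] using x.le_opNorm (η n)
  have h3 : ‖c • η n‖ ≤ ‖x (η n) - c • η n‖ + ‖x (η n)‖ := by
    rw [norm_sub_rev]
    simpa using norm_add_le (c • η n - x (η n)) (x (η n))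
  linarith

theorem isClosed_isAsympEig {η : ℕ → L2} (hη : ∀ n, ‖η n‖ = 1) :
    IsClosed {p : (L2 →L[ℂ] L2) × ℂ | IsAsympEig η p.1 p.2} := by
  refine isClosed_of_closure_subset fun p hp => ?_
  refine Metric.tendsto_atTop.2 fun ε hε => ?_
  obtain ⟨q, hq, hpq⟩ := Metric.mem_closure_iff.1 hp (ε / 3) (by positivity)
  obtain ⟨N, hN⟩ := Metric.tendsto_atTop.1 hq (ε / 3) (by positivity)
  refine ⟨N, fun n hn => ?_⟩
  have h1 := hN n hn
  rw [dist_zero_right] at h1 ⊢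
  rw [Prod.dist_eq, max_lt_iff, dist_eq_norm, dist_eq_norm] at hpq
  have h2 : ‖(p.1 - q.1) (η n)‖ ≤ ‖p.1 - q.1‖ := by simpa [hη] using (p.1 - q.1).le_opNorm (η n)
  have h3 : ‖(p.2 - q.2) • η n‖ = ‖p.2 - q.2‖ := by rw [norm_smul, hη, mul_one]
  have h4 : p.1 (η n) - p.2 • η n =
      (p.1 - q.1) (η n) - (p.2 - q.2) • η n + (q.1 (η n) - q.2 • η n) := by
    rw [_root_.sub_apply, sub_smul]
    abel
  rw [h4]
  have h5 := norm_add_le ((p.1 - q.1) (η n) - (p.2 - q.2) • η n) (q.1 (η n) - q.2 • η n)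
  have h6 := norm_sub_le ((p.1 - q.1) (η n)) ((p.2 - q.2) • η n)
  linarith [hpq.1, hpq.2]

/-- Pairs `(x, f)` of an operator and a function such that the vectors `eig z n` are
asymptotically eigenvectors of `x` and of its adjoint, for the eigenvalues `f z` and
`star (f z)`. -/
def symbolGraph : StarSubalgebra ℂ ((L2 →L[ℂ] L2) × C(Circle, ℂ)) where
  carrier := {x | ∀ z, IsAsympEig (eig z) x.1 (x.2 z) ∧
    IsAsympEig (eig z) (star x.1) (star (x.2 z))}
  mul_mem' {x y} hx hy z := by
    refine ⟨(hx z).1.mul (hy z).1, ?_⟩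
    have h := (hy z).2.mul (hx z).2
    rw [← star_mul, ← star_mul] at h
    exact h
  add_mem' {x y} hx hy z := by
    refine ⟨(hx z).1.add (hy z).1, ?_⟩
    have h := (hx z).2.add (hy z).2
    rw [← star_add, ← star_add] at h
    exact h
  algebraMap_mem' c z := by
    refine ⟨isAsympEig_algebraMap _ c, ?_⟩
    have h := isAsympEig_algebraMap (eig z) (star c)
    rw [algebraMap_star_comm] at h
    exact h
  star_mem' {x} hx z := by
    refine ⟨(hx z).2, ?_⟩
    have h := (hx z).1
    rw [← star_star x.1, ← star_star (x.2 z)] at h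
    exact h

theorem isClosed_symbolGraph :
    IsClosed (symbolGraph : Set ((L2 →L[ℂ] L2) × C(Circle, ℂ))) := by
  have h : (symbolGraph : Set ((L2 →L[ℂ] L2) × C(Circle, ℂ))) = ⋂ z,
      ((fun x => (x.1, x.2 z)) ⁻¹' {p : (L2 →L[ℂ] L2) × ℂ | IsAsympEig (eig z) p.1 p.2}) ∩
      ((fun x => (star x.1, star (x.2 z))) ⁻¹'
        {p : (L2 →L[ℂ] L2) × ℂ | IsAsympEig (eig z) p.1 p.2}) := by
    ext x
    rw [Set.mem_iInter]
    rfl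
  rw [h]
  refine isClosed_iInter fun z => ?_
  have h1 : Continuous fun x : (L2 →L[ℂ] L2) × C(Circle, ℂ) => x.2 z :=
    (continuous_eval_const z).comp continuous_snd
  exact ((isClosed_isAsympEig (norm_eig z)).preimage (continuous_fst.prodMk h1)).inter
    ((isClosed_isAsympEig (norm_eig z)).preimage (continuous_fst.star.prodMk h1.star))

theorem norm_snd_le (x : symbolGraph) : ‖x.1.2‖ ≤ ‖x.1.1‖ :=
  (ContinuousMap.norm_le _ (norm_nonneg _)).2 fun z => (x.2 z).1.norm_le (norm_eig z)

theorem shift_u_mem : (shift, u) ∈ symbolGraph :=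
  fun z => ⟨tendsto_shift_eig z, tendsto_star_shift_eig z⟩

/-- The projection of `symbolGraph` to the operators. -/
def symbolFst : symbolGraph →⋆ₐ[ℂ] (L2 →L[ℂ] L2) :=
  (StarAlgHom.fst ℂ (L2 →L[ℂ] L2) C(Circle, ℂ)).comp symbolGraph.subtype

theorem isometry_symbolFst : Isometry symbolFst := by
  refine AddMonoidHomClass.isometry_of_norm symbolFst fun x => ?_
  exact (max_eq_left (norm_snd_le x)).symm

theorem elemental_le_range : StarAlgebra.elemental ℂ shift ≤ symbolFst.range := by
  have : CompleteSpace symbolGraph := isClosed_symbolGraph.completeSpace_coe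
  have hc : IsClosed (symbolFst.range : Set (L2 →L[ℂ] L2)) := by
    have h : (symbolFst.range : Set (L2 →L[ℂ] L2)) = Set.range symbolFst := by
      ext x
      rfl
    rw [h]
    exact isometry_symbolFst.isClosedEmbedding.isClosed_range
  refine (StarAlgebra.elemental.le_iff_mem (s := symbolFst.range) hc).2 ?_
  exact ⟨⟨_, shift_u_mem⟩, rfl⟩

/-- The symbol map `σ : 𝒯 → C(S¹)` of the Toeplitz algebra, the `*`-homomorphism that sends the
generating isometry to the standard unitary generator. -/
def symbol : ToeplitzAlgebra →⋆ₐ[ℂ] C(Circle, ℂ) :=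
  ((StarAlgHom.snd ℂ (L2 →L[ℂ] L2) C(Circle, ℂ)).comp symbolGraph.subtype).comp
    (((StarAlgEquiv.ofInjective symbolFst isometry_symbolFst.injective).symm :
      symbolFst.range →⋆ₐ[ℂ] symbolGraph).comp (StarSubalgebra.inclusion elemental_le_range))

theorem symbol_s : symbol s = u := by
  have h : (StarAlgEquiv.ofInjective symbolFst isometry_symbolFst.injective).symm
      (StarSubalgebra.inclusion elemental_le_range s) = ⟨_, shift_u_mem⟩ := by
    rw [StarAlgEquiv.symm_apply_eq]
    rfl
  exact congrArg (fun x : symbolGraph => x.1.2) h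

end Toeplitz

/-! ### Pullback diagrams and quotient maps of C*-algebras -/

/-- `φ : A → B` is a quotient map of `A` by the ideal `I`: it is surjective and its kernel
is `I`. -/
def IsQuotientBy {A B : Type*} [NonUnitalCStarAlgebra A] [NonUnitalCStarAlgebra B]
    (φ : A →⋆ₙₐ[ℂ] B) (I : Set A) : Prop :=
  Function.Surjective φ ∧ ∀ x, φ x = 0 ↔ x ∈ I

/-- The square with the maps `φ₁ : A → B₁`, `φ₂ : A → B₂`, `ψ₁ : B₁ → D`, `ψ₂ : B₂ → D` is a
pullback diagram: it commutes, and `x ↦ (φ₁ x, φ₂ x)` is a bijection (hence an isomorphism of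
C*-algebras) of `A` onto `{(b₁, b₂) | ψ₁ b₁ = ψ₂ b₂}`. -/
structure IsPullbackDiagram {A B₁ B₂ D : Type*} [NonUnitalCStarAlgebra A]
    [NonUnitalCStarAlgebra B₁] [NonUnitalCStarAlgebra B₂] [NonUnitalCStarAlgebra D]
    (φ₁ : A →⋆ₙₐ[ℂ] B₁) (φ₂ : A →⋆ₙₐ[ℂ] B₂) (ψ₁ : B₁ →⋆ₙₐ[ℂ] D) (ψ₂ : B₂ →⋆ₙₐ[ℂ] D) : Prop where
  comm : ∀ x, ψ₁ (φ₁ x) = ψ₂ (φ₂ x)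
  existsUnique : ∀ b₁ b₂, ψ₁ b₁ = ψ₂ b₂ → ∃! x, φ₁ x = b₁ ∧ φ₂ x = b₂

/-- The standard action of `U(1)` on `C(S¹)`: `(z · f)(w) = f (z w)`. -/
def circleRotation (z : Circle) (f : C(Circle, ℂ)) : C(Circle, ℂ) :=
  ⟨fun w => f (z * w), by fun_prop⟩

end

/-! Let I and J be the closed ideals of C*(Q_l) generated by the projection of the last vertex
v¹_{l-1} and by the projections P_v, v ∈ H. The pullback property rests on I ∩ J = 0, and here
already the product J I vanishes: the last vertex is a sink because its loop was removed, and no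
vertex of H reaches it, so P_v a P_w = 0 for v ∈ H, w = v¹_{l-1} and every a
(`P_mul_mul_P_lastVertex`). An element killed by both χ₁ and χ₂ is therefore zero (`eq_of_chi1_eq`).
To reach a compatible pair (a, b), lift a to some x. The difference b - χ₂(x) lies in the kernel of
σ, which is the ideal generated by the sink projection of Q_l/H, and χ₂ maps I onto this ideal.
Hence x can be corrected by an element of I = ker χ₁ (`exists_chi1_eq`).

Three facts support this argument.

Exactness: the kernel of C*(E) → C*(E/H) is the closed ideal generated by the P_v, v ∈ H. The
distance to this ideal is a C*-seminorm on polynomials in the generators of E/H that respects the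
Cuntz–Krieger relations, so the universal norm dominates it (`distSeminorm_le_norm_quotientMap`).
Its C*-identity comes from approximate units (`distSeminorm_mul_self_le`).

One vertex with one loop gives C(S¹): the functional calculus of a unitary supplies a left inverse
(`injective_loopHom`).

A loop with an exit to a sink gives 𝒯: followed by σ, the representation on ℓ²(ℕ) becomes the
quotient by the sink, so its kernel lies in the ideal of the sink. There it is faithful, because the
corner of a sink is one-dimensional and the sink projection acts as 1 - ss* ≠ 0
(`injective_toeplitzHom`).

Commutativity and equivariance are equalities of `*`-homomorphisms and are checked on generators. -/

noncomputable section

/-! ### Closed ideals of C*-algebras -/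

namespace CStarIdeal

open CStarAlgebra Unitization Filter Topology

variable {A : Type*} [NonUnitalCStarAlgebra A] (J : NonUnitalStarSubalgebra ℂ A)

/-- A closed `*`-subalgebra is a C*-algebra in its own right, so it has an approximate unit of
positive contractions, from which `e` is taken. The algebra `A` may lack a unit; in the unitization
0 ≤ e ≤ 1 gives 0 ≤ 1 - e ≤ 1. -/
theorem exists_norm_sub_mul_lt [IsClosed (J : Set A)] {j : A} (hj : j ∈ J) {ε : ℝ} (hε : 0 < ε) :
    ∃ e ∈ J, star e = e ∧ ‖(1 : A⁺¹) - e‖ ≤ 1 ∧ ‖j - j * e‖ < ε := by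
  let _ : PartialOrder J := CStarAlgebra.spectralOrder J
  have : StarOrderedRing J := CStarAlgebra.spectralOrderedRing J
  let _ : PartialOrder A⁺¹ := CStarAlgebra.spectralOrder A⁺¹
  have : StarOrderedRing A⁺¹ := CStarAlgebra.spectralOrderedRing A⁺¹
  have hu := CStarAlgebra.increasingApproximateUnit J
  have h1 : ∀ᶠ e in CStarAlgebra.approximateUnit J, ‖(⟨j, hj⟩ : J) * e - ⟨j, hj⟩‖ < ε := by
    have := (hu.tendsto_mul_left ⟨j, hj⟩).eventually (Metric.ball_mem_nhds _ hε)
    simpa [dist_eq_norm] using this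
  obtain ⟨e, ⟨he, he0⟩, he1⟩ := ((h1.and hu.eventually_nonneg).and hu.eventually_norm).exists
  have hs : star e = e := he0.isSelfAdjoint
  refine ⟨e, e.2, congrArg Subtype.val hs, ?_, ?_⟩
  · let φ : J →⋆ₙₐ[ℂ] A⁺¹ := (Unitization.inrNonUnitalStarAlgHom ℂ A).comp
      (NonUnitalStarSubalgebraClass.subtype J)
    have h0 : 0 ≤ φ e := map_nonneg φ he0
    have hn : ‖φ e‖ ≤ 1 := (NonUnitalStarAlgHom.norm_apply_le φ e).trans he1
    have hm : φ e ∈ Set.Icc 0 1 := mem_Icc_iff_norm_le_one.2 ⟨h0, hn⟩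
    exact (mem_Icc_iff_norm_le_one.1 (Set.sub_mem_Icc_zero_iff_right.2 hm)).2
  · rw [norm_sub_rev]
    exact he

/-- The distance to `J`, as a seminorm. -/
def distSeminorm : Seminorm ℂ A :=
  (normSeminorm ℂ (A ⧸ J.toSubmodule)).comp J.toSubmodule.mkQ

variable {J}

theorem distSeminorm_le {j : A} (hj : j ∈ J) (a : A) : distSeminorm J a ≤ ‖a - j‖ := by
  have h : J.toSubmodule.mkQ a = J.toSubmodule.mkQ (a - j) :=
    (Submodule.Quotient.eq _).2 (by simpa using hj)
  change ‖J.toSubmodule.mkQ a‖ ≤ _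
  rw [h]
  exact Submodule.Quotient.norm_mk_le _ _

theorem distSeminorm_le_norm (a : A) : distSeminorm J a ≤ ‖a‖ := by
  simpa using distSeminorm_le (zero_mem J) a

variable (J) in
theorem continuous_distSeminorm : Continuous (distSeminorm J) :=
  Seminorm.continuous_of_le (q := normSeminorm ℂ A) continuous_norm
    fun a => distSeminorm_le_norm a

theorem exists_of_distSeminorm_lt {a : A} {r : ℝ} (h : distSeminorm J a < r) :
    ∃ j ∈ J, ‖a - j‖ < r := by
  obtain ⟨b, hb, hr⟩ := Submodule.Quotient.norm_mk_lt (J.toSubmodule.mkQ a) (sub_pos.2 h)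
  refine ⟨a - b, ?_, ?_⟩
  · have := (Submodule.Quotient.eq _).1 hb
    rw [← neg_sub]
    exact neg_mem this
  · have : ‖b‖ < distSeminorm J a + (r - distSeminorm J a) := hr
    rw [sub_sub_cancel]
    linarith

theorem distSeminorm_eq_zero_of_mem {a : A} (ha : a ∈ J) : distSeminorm J a = 0 :=
  le_antisymm (by simpa using distSeminorm_le ha a) (apply_nonneg _ _)

theorem mem_of_distSeminorm_eq_zero (hc : IsClosed (J : Set A)) {a : A}
    (h : distSeminorm J a = 0) : a ∈ J := by
  refine hc.closure_subset (Metric.mem_closure_iff.2 fun ε hε => ?_)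
  obtain ⟨j, hj, hr⟩ := exists_of_distSeminorm_lt (h.trans_lt hε)
  exact ⟨j, hj, by rwa [dist_eq_norm]⟩

/-- If i and j are nearly optimal approximants of a and b in the ideal, then (a - i)(b - j) differs
from ab by an element of the ideal. The error ε tends to 0 at the end. -/
theorem distSeminorm_mul_le (hl : ∀ a, ∀ j ∈ J, a * j ∈ J) (hr : ∀ a, ∀ j ∈ J, j * a ∈ J)
    (a b : A) : distSeminorm J (a * b) ≤ distSeminorm J a * distSeminorm J b := by
  have h (ε : ℝ) (hε : 0 < ε) :
      distSeminorm J (a * b) ≤ (distSeminorm J a + ε) * (distSeminorm J b + ε) := by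
    obtain ⟨i, hi, hi'⟩ := exists_of_distSeminorm_lt (lt_add_of_pos_right (distSeminorm J a) hε)
    obtain ⟨j, hj, hj'⟩ := exists_of_distSeminorm_lt (lt_add_of_pos_right (distSeminorm J b) hε)
    have hm : a * j + i * (b - j) ∈ J := add_mem (hl _ _ hj) (hr _ _ hi)
    refine (distSeminorm_le hm _).trans ?_
    have : a * b - (a * j + i * (b - j)) = (a - i) * (b - j) := by noncomm_ring
    rw [this]
    exact (norm_mul_le _ _).trans
      (mul_le_mul hi'.le hj'.le (norm_nonneg _) (add_nonneg (apply_nonneg _ _) hε.le))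
  have hc : Tendsto (fun ε : ℝ => (distSeminorm J a + ε) * (distSeminorm J b + ε)) (𝓝[>] 0)
      (𝓝 ((distSeminorm J a + 0) * (distSeminorm J b + 0))) :=
    Tendsto.mono_left (Continuous.tendsto (by fun_prop) 0) nhdsWithin_le_nhds
  rw [add_zero, add_zero] at hc
  exact ge_of_tendsto hc (eventually_nhdsWithin_of_forall fun ε hε => h ε hε)

/-- The C*-identity for the quotient norm. Take j ∈ J almost optimal for a*a and e ∈ J almost a unit
for j. Since ae ∈ J, the distance of a is at most ‖a(1 - e)‖, and ‖a(1 - e)‖² = ‖(1 - e) a*a (1 -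
e)‖. Replacing a*a by a*a - j costs only ‖j - je‖, and the factors 1 - e are contractions. -/
theorem distSeminorm_mul_self_le (hc : IsClosed (J : Set A)) (hl : ∀ a, ∀ j ∈ J, a * j ∈ J)
    (a : A) : distSeminorm J a * distSeminorm J a ≤ distSeminorm J (star a * a) := by
  refine le_of_forall_pos_le_add fun ε hε => ?_
  obtain ⟨j, hj, hj'⟩ :=
    exists_of_distSeminorm_lt (lt_add_of_pos_right (distSeminorm J (star a * a)) (half_pos hε))
  have : IsClosed (J : Set A) := hc
  obtain ⟨e, he, hes, he1, hje⟩ := exists_norm_sub_mul_lt J hj (half_pos hε)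
  have h1 : ‖a - a * e‖ * ‖a - a * e‖ ≤ ‖star a * a - j‖ + ‖j - j * e‖ := by
    rw [← CStarRing.norm_star_mul_self]
    have hs : star ((1 : A⁺¹) - e) = 1 - e := by
      rw [star_sub, star_one, ← Unitization.inr_star, hes]
    have h2 : ((star (a - a * e) * (a - a * e) : A) : A⁺¹) =
        (1 - (e : A⁺¹)) * ((star a * a - j : A) * (1 - (e : A⁺¹)) + (j - j * e : A)) := by
      simp only [Unitization.inr_mul, Unitization.inr_sub, Unitization.inr_star, star_sub,
        star_mul]
      rw [← Unitization.inr_star e, hes]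
      noncomm_ring
    rw [← Unitization.norm_inr (𝕜 := ℂ), h2]
    calc _ ≤ ‖(1 - (e : A⁺¹))‖ *
          (‖((star a * a - j : A) : A⁺¹)‖ * ‖(1 - (e : A⁺¹))‖ + ‖((j - j * e : A) : A⁺¹)‖) :=
          (norm_mul_le _ _).trans (mul_le_mul_of_nonneg_left
            ((norm_add_le _ _).trans (add_le_add_left (norm_mul_le _ _) _)) (norm_nonneg _))
      _ ≤ 1 * (‖((star a * a - j : A) : A⁺¹)‖ * 1 + ‖((j - j * e : A) : A⁺¹)‖) := by gcongr
      _ = _ := by rw [one_mul, mul_one, Unitization.norm_inr, Unitization.norm_inr]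
  have h3 := distSeminorm_le (hl a e he) a
  have h4 := mul_self_le_mul_self (apply_nonneg (distSeminorm J) a) h3
  linarith

end CStarIdeal

end

/-! ### Graph C*-algebras: generators, vertex ideals, exactness of quotients. -/

noncomputable section

namespace RowFiniteGraph

open GraphCStar CStarIdeal

variable {E : RowFiniteGraph}

/-! ### Induction principles -/

theorem preAlg_induction {p : E.PreAlg → Prop} (preP : ∀ v, p (E.preP v))
    (preS : ∀ e, p (E.preS e)) (zero : p 0) (add : ∀ x y, p x → p y → p (x + y))
    (mul : ∀ x y, p x → p y → p (x * y)) (smul : ∀ (c : ℂ) x, p x → p (c • x))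
    (hstar : ∀ x, p x → p (star x)) (x : E.PreAlg) : p x := by
  have hword (w : StarWord (E.Vert ⊕ E.Edge)) : p (FreeStarAlg.mono w 1 : FreeStarAlg _) := by
    have hgen (y : E.Vert ⊕ E.Edge) : p (FreeStarAlg.gen y : FreeStarAlg _) := by
      rcases y with v | e
      · exact preP v
      · exact preS e
    induction w using FreeSemigroup.recOnMul with
    | ih1 a =>
      rcases a with ⟨y, _ | _⟩
      · exact hgen y
      · have h : (FreeStarAlg.mono (FreeSemigroup.of (y, true)) 1 : E.PreAlg) =
            star (FreeStarAlg.gen y : E.PreAlg) := by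
          refine Eq.trans ?_ (FreeStarAlg.star_mono _ _).symm
          simp [star_of]
        rw [h]
        exact hstar _ (hgen y)
    | ih2 a w ha hw =>
      have h : (FreeStarAlg.mono (FreeSemigroup.of a * w) 1 : E.PreAlg) =
          (FreeStarAlg.mono (FreeSemigroup.of a) 1 : E.PreAlg) *
            (FreeStarAlg.mono w 1 : E.PreAlg) := by
        refine Eq.trans ?_ (FreeStarAlg.mono_mul_mono _ _ _ _).symm
        simp
      rw [h]
      exact mul _ _ ha hw
  induction x using FreeStarAlg.induction with
  | h0 => exact zero
  | hadd x y hx hy => exact add x y hx hy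
  | hmono w c =>
    have h : (FreeStarAlg.mono w c : E.PreAlg) = c • (FreeStarAlg.mono w 1 : E.PreAlg) := by
      refine Eq.trans ?_ (FreeStarAlg.smul_mono _ _ _).symm
      simp
    rw [h]
    exact smul c _ (hword w)

/-- The main induction tool: a property of all elements is proved by exhibiting the elements that
have it as a closed `*`-subalgebra. When the property is not symmetric under the adjoint, it is
strengthened until it is. -/
theorem mem_of_isClosed (B : NonUnitalStarSubalgebra ℂ E.CStar)
    (hc : IsClosed (B : Set E.CStar)) (hP : ∀ v, E.P v ∈ B) (hS : ∀ e, E.S e ∈ B)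
    (x : E.CStar) : x ∈ B := by
  induction x using denseRange_of.induction_on with
  | hp => exact hc
  | ih a =>
    induction a using preAlg_induction with
    | preP v => exact hP v
    | preS e => exact hS e
    | zero => rw [map_zero]; exact zero_mem B
    | add x y hx hy => rw [map_add]; exact add_mem hx hy
    | mul x y hx hy => rw [map_mul]; exact mul_mem hx hy
    | smul c x hx => rw [map_smul]; exact SMulMemClass.smul_mem c hx
    | hstar x hx => rw [map_star]; exact star_mem hx

theorem continuous_hom {B : Type*} [NonUnitalCStarAlgebra B] (f : E.CStar →⋆ₙₐ[ℂ] B) :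
    Continuous f :=
  AddMonoidHomClass.continuous_of_bound f 1 fun x => by
    simpa using NonUnitalStarAlgHom.norm_apply_le f x

/-- `*`-homomorphisms on `C*(E)` are determined by their values on the generators. -/
theorem hom_ext {B : Type*} [NonUnitalCStarAlgebra B] {f g : E.CStar →⋆ₙₐ[ℂ] B}
    (hP : ∀ v, f (E.P v) = g (E.P v)) (hS : ∀ e, f (E.S e) = g (E.S e)) : f = g := by
  ext x
  exact mem_of_isClosed (NonUnitalStarAlgHom.equalizer f g)
    (isClosed_eq (continuous_hom f) (continuous_hom g)) hP hS x

/-! ### Consequences of the Cuntz--Krieger relations -/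

theorem S_mul_P (e : E.Edge) : E.S e * E.P (E.rng e) = E.S e := by
  rw [← E.isCuntzKrieger.ck1, ← mul_assoc, E.isCuntzKrieger.partial_isometry]

/-- A sum of positive elements vanishes only if each summand does. This turns the summed relation
`ck2` into statements about single edges. -/
theorem eq_zero_of_sum_star_mul_self {A ι : Type*} [NonUnitalCStarAlgebra A] {s : Finset ι}
    {y : ι → A} (h : ∑ i ∈ s, star (y i) * y i = 0) {i : ι} (hi : i ∈ s) : y i = 0 := by
  let _ : PartialOrder A := CStarAlgebra.spectralOrder A
  have : StarOrderedRing A := CStarAlgebra.spectralOrderedRing A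
  exact (CStarRing.star_mul_self_eq_zero_iff _).1
    ((Finset.sum_eq_zero_iff_of_nonneg fun j _ => star_mul_self_nonneg (y j)).1 h i hi)

/-- With p the projection of the source v, put y_f = S_f*(1 - p) for the edges f out of v. By `ck2`,
∑ y_f* y_f = (1 - p) p (1 - p) = 0, so every y_f is zero. -/
theorem star_S_mul_P_src (e : E.Edge) : star (E.S e) * E.P (E.src e) = star (E.S e) := by
  have hE := E.isCuntzKrieger
  have hsum := hE.ck2 (E.src e) fun h => h e rfl
  have h := eq_zero_of_sum_star_mul_self (s := E.out (E.src e))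
    (y := fun f => star (E.S f) - star (E.S f) * E.P (E.src e)) ?_ (mem_out.2 rfl)
  · exact (sub_eq_zero.1 h).symm
  · have h1 (f : E.Edge) : star (star (E.S f) - star (E.S f) * E.P (E.src e)) *
        (star (E.S f) - star (E.S f) * E.P (E.src e)) =
        E.S f * star (E.S f) - E.S f * star (E.S f) * E.P (E.src e) -
        E.P (E.src e) * (E.S f * star (E.S f)) +
        E.P (E.src e) * (E.S f * star (E.S f)) * E.P (E.src e) := by
      rw [star_sub, star_mul, star_star, hE.star_P]
      noncomm_ring
    simp only [h1, Finset.sum_add_distrib, Finset.sum_sub_distrib, ← Finset.sum_mul,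
      ← Finset.mul_sum, hsum, hE.P_mul_self]
    abel

theorem P_src_mul_S (e : E.Edge) : E.P (E.src e) * E.S e = E.S e := by
  have := congrArg star (star_S_mul_P_src e)
  rwa [star_mul, star_star, E.isCuntzKrieger.star_P] at this

/-- For a common source, the sum over all edges g ≠ f from that vertex of S_f* S_g S_g* S_f is
S_f*(P - S_f S_f*) S_f = 0 by `ck2`, and all its terms are positive. For distinct sources the source
projections are orthogonal. -/
theorem star_S_mul_S_of_ne {e f : E.Edge} (h : e ≠ f) : star (E.S e) * E.S f = 0 := by
  classical
  have hE := E.isCuntzKrieger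
  by_cases hs : E.src e = E.src f
  · have hsum := hE.ck2 (E.src f) fun h => h f rfl
    have hf : f ∈ E.out (E.src f) := mem_out.2 rfl
    have he : e ∈ (E.out (E.src f)).erase f := Finset.mem_erase.2 ⟨h, mem_out.2 hs⟩
    refine eq_zero_of_sum_star_mul_self (s := (E.out (E.src f)).erase f)
      (y := fun g => star (E.S g) * E.S f) ?_ he
    have h1 (g : E.Edge) : star (star (E.S g) * E.S f) * (star (E.S g) * E.S f) =
        star (E.S f) * (E.S g * star (E.S g)) * E.S f := by
      rw [star_mul, star_star]
      noncomm_ring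
    simp only [h1, ← Finset.sum_mul, ← Finset.mul_sum]
    rw [← Finset.add_sum_erase _ _ hf] at hsum
    rw [eq_sub_of_add_eq' hsum, mul_sub, sub_mul, mul_assoc _ (E.P _), P_src_mul_S, ← mul_assoc,
      mul_assoc _ _ (E.S f), sub_eq_zero, hE.ck1, hE.P_mul_self]
  · rw [← star_S_mul_P_src, ← P_src_mul_S f, ← mul_assoc, mul_assoc _ (E.P _) (E.P _),
      hE.P_mul_P _ _ hs, mul_zero, zero_mul]

/-! ### Closed ideals generated by vertex projections -/

section ClosedIdeal

variable {H : Set E.Vert}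

theorem P_mem_closedIdeal {v : E.Vert} (hv : v ∈ H) : E.P v ∈ E.closedIdeal H :=
  subset_closure (TwoSidedIdeal.subset_span ⟨v, hv, rfl⟩)

theorem closedIdeal_induction {p : E.CStar → Prop} (hc : IsClosed {x | p x})
    (P : ∀ v ∈ H, p (E.P v)) (zero : p 0) (add : ∀ x y, p x → p y → p (x + y))
    (neg : ∀ x, p x → p (-x)) (left : ∀ a x, p x → p (a * x)) (right : ∀ a x, p x → p (x * a))
    {x : E.CStar} (hx : x ∈ E.closedIdeal H) : p x := by
  refine closure_minimal (fun y hy => ?_) hc hx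
  induction hy using TwoSidedIdeal.span_induction with
  | mem y hy =>
    obtain ⟨v, hv, rfl⟩ := hy
    exact P v hv
  | zero => exact zero
  | add x y _ _ hx hy => exact add x y hx hy
  | neg x _ hx => exact neg x hx
  | left_absorb a x _ hx => exact left a x hx
  | right_absorb a x _ hx => exact right a x hx

theorem mul_mem_closedIdeal_left (a : E.CStar) {x : E.CStar} (hx : x ∈ E.closedIdeal H) :
    a * x ∈ E.closedIdeal H :=
  map_mem_closure (continuous_const_mul a) hx fun _ hy => TwoSidedIdeal.mul_mem_left _ _ _ hy

theorem mul_mem_closedIdeal_right (a : E.CStar) {x : E.CStar} (hx : x ∈ E.closedIdeal H) :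
    x * a ∈ E.closedIdeal H :=
  map_mem_closure (f := fun y => y * a) (continuous_id.mul continuous_const) hx
    fun _ hy => TwoSidedIdeal.mul_mem_right _ _ _ hy

theorem add_mem_closedIdeal {x y : E.CStar} (hx : x ∈ E.closedIdeal H)
    (hy : y ∈ E.closedIdeal H) : x + y ∈ E.closedIdeal H :=
  map_mem_closure₂ continuous_add hx hy fun _ hx _ hy => add_mem hx hy

theorem zero_mem_closedIdeal : (0 : E.CStar) ∈ E.closedIdeal H := subset_closure (zero_mem _)

/-- The span is a ring-theoretic ideal of a ring that need not have a unit, so stability under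
scalars is not automatic. It follows from cP = (cP)P for the generating projections. -/
theorem smul_mem_closedIdeal (c : ℂ) {x : E.CStar} (hx : x ∈ E.closedIdeal H) :
    c • x ∈ E.closedIdeal H := by
  refine closedIdeal_induction (p := fun x => c • x ∈ E.closedIdeal H) ?_ ?_ ?_ ?_ ?_ ?_ ?_ hx
  · exact isClosed_closure.preimage (continuous_const_smul c)
  · intro v hv
    rw [← E.isCuntzKrieger.P_mul_self, ← smul_mul_assoc]
    exact mul_mem_closedIdeal_left _ (P_mem_closedIdeal hv)
  · rw [smul_zero]
    exact zero_mem_closedIdeal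
  · intro x y hx hy
    rw [smul_add]
    exact add_mem_closedIdeal hx hy
  · intro x hx
    rw [smul_neg]
    exact map_mem_closure continuous_neg hx fun _ hy => neg_mem hy
  · intro a x hx
    rw [← mul_smul_comm]
    exact mul_mem_closedIdeal_left a hx
  · intro a x hx
    rw [← smul_mul_assoc]
    exact mul_mem_closedIdeal_right a hx

theorem star_mem_closedIdeal {x : E.CStar} (hx : x ∈ E.closedIdeal H) :
    star x ∈ E.closedIdeal H := by
  refine closedIdeal_induction (p := fun x => star x ∈ E.closedIdeal H) ?_ ?_ ?_ ?_ ?_ ?_ ?_ hx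
  · exact isClosed_closure.preimage continuous_star
  · intro v hv
    rw [E.isCuntzKrieger.star_P]
    exact P_mem_closedIdeal hv
  · rw [star_zero]
    exact zero_mem_closedIdeal
  · intro x y hx hy
    rw [star_add]
    exact add_mem_closedIdeal hx hy
  · intro x hx
    rw [star_neg]
    exact map_mem_closure continuous_neg hx fun _ hy => neg_mem hy
  · intro a x hx
    rw [star_mul]
    exact mul_mem_closedIdeal_right _ hx
  · intro a x hx
    rw [star_mul]
    exact mul_mem_closedIdeal_left _ hx

variable (H) in
/-- The closed ideal generated by the projections `P v`, `v ∈ H`, as a `*`-subalgebra. -/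
def idealSubalgebra : NonUnitalStarSubalgebra ℂ E.CStar where
  carrier := E.closedIdeal H
  add_mem' := add_mem_closedIdeal
  zero_mem' := zero_mem_closedIdeal
  mul_mem' _ hy := mul_mem_closedIdeal_left _ hy
  smul_mem' c _ hx := smul_mem_closedIdeal c hx
  star_mem' := star_mem_closedIdeal

theorem isClosed_idealSubalgebra : IsClosed (idealSubalgebra H : Set E.CStar) := isClosed_closure

end ClosedIdeal

/-! ### Exactness -/

section Exact

variable (H : E.SatHereditary)

/-- The inclusion of generators of `C*(E / H)` into `C*(E)`, extended to `*`-polynomials. -/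
def liftQuot : (E.quotient H).PreAlg →⋆ₙₐ[ℂ] E.CStar :=
  preLift (fun v => E.P v.1) (fun e => E.S e.1)

theorem liftQuot_preP (v : (E.quotient H).Vert) :
    liftQuot H ((E.quotient H).preP v) = E.P v.1 := preLift_preP _ _ v

theorem liftQuot_preS (e : (E.quotient H).Edge) :
    liftQuot H ((E.quotient H).preS e) = E.S e.1 := preLift_preS _ _ e

/-- The distance of `liftQuot H x` to the closed ideal generated by `P v`, `v ∈ H`. -/
def quotSeminorm : Seminorm ℂ (E.quotient H).PreAlg :=
  (distSeminorm (idealSubalgebra H.carrier)).comp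
    ((liftQuot H : (E.quotient H).PreAlg →ₙₐ[ℂ] E.CStar) : (E.quotient H).PreAlg →ₗ[ℂ] E.CStar)

theorem quotSeminorm_apply (x : (E.quotient H).PreAlg) :
    quotSeminorm H x = distSeminorm (idealSubalgebra H.carrier) (liftQuot H x) := rfl

variable {H} in
theorem S_mem_closedIdeal {e : E.Edge} (he : E.rng e ∈ H.carrier) :
    E.S e ∈ E.closedIdeal H.carrier := by
  rw [← S_mul_P]
  exact mul_mem_closedIdeal_left _ (P_mem_closedIdeal he)

/-- The generators outside `H` satisfy the relations of E/H modulo the ideal. Only `ck2` is not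
already true in C*(E): its sum over E/H omits the terms S_e S_e* with range in `H`, and these lie in
the ideal. -/
theorem isCKSeminorm_quotSeminorm : (E.quotient H).IsCKSeminorm (quotSeminorm H) where
  mul_le x y := by
    simp only [quotSeminorm_apply, map_mul]
    exact distSeminorm_mul_le (fun a _ hj => mul_mem_closedIdeal_left a hj)
      (fun a _ hj => mul_mem_closedIdeal_right a hj) _ _
  star_mul x := by
    have hl (a : E.CStar) (j) (hj : j ∈ idealSubalgebra H.carrier) :
        a * j ∈ idealSubalgebra H.carrier := mul_mem_closedIdeal_left a hj
    have hr (a : E.CStar) (j) (hj : j ∈ idealSubalgebra H.carrier) :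
        j * a ∈ idealSubalgebra H.carrier := mul_mem_closedIdeal_right a hj
    have hmul := distSeminorm_mul_le hl hr
    have hself := distSeminorm_mul_self_le isClosed_idealSubalgebra hl
    -- For the distance d, the chain d(a)² ≤ d(a*a) ≤ d(a*) d(a) gives d(a) ≤ d(a*). Invariance
    -- under the adjoint then upgrades the C*-inequality to an equality.
    have hstar (a : E.CStar) : distSeminorm (idealSubalgebra H.carrier) a ≤
        distSeminorm (idealSubalgebra H.carrier) (star a) := by
      rcases (apply_nonneg (distSeminorm (idealSubalgebra H.carrier)) a).eq_or_lt with h | h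
      · rw [← h]; exact apply_nonneg _ _
      · exact le_of_mul_le_mul_right ((hself a).trans (hmul _ _)) h
    simp only [quotSeminorm_apply, map_mul, map_star]
    refine le_antisymm ((hmul _ _).trans ?_) (hself _)
    refine mul_le_mul_of_nonneg_right ?_ (apply_nonneg _ _)
    simpa using hstar (star (liftQuot H x))
  relator x hx := by
    have hE := E.isCuntzKrieger
    refine distSeminorm_eq_zero_of_mem (J := idealSubalgebra H.carrier) ?_
    change liftQuot H x ∈ idealSubalgebra H.carrier
    unfold liftQuot
    cases hx with
    | star_P v => simp [map_star, preLift_preP, hE.star_P]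
    | P_mul_self v => simp [preLift_preP, hE.P_mul_self]
    | P_mul_P v w hvw =>
      simp [preLift_preP, hE.P_mul_P v.1 w.1 fun h => hvw (Subtype.ext h)]
    | partial_isometry e => simp [map_star, preLift_preS, hE.partial_isometry]
    | ck1 e =>
      have : (((E.quotient H).rng e).1 : E.Vert) = E.rng e.1 := rfl
      simp [map_star, preLift_preS, preLift_preP, hE.ck1, this]
    | ck2 v hv =>
      classical
      have hv' : ¬ E.IsSink v.1 := fun hs => hv fun e he => hs e.1 (congrArg Subtype.val he)
      have hsum : ∑ e ∈ (E.quotient H).out v, E.S e.1 * star (E.S e.1) =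
          ∑ e ∈ E.out v.1 with E.rng e ∉ H.carrier, E.S e * star (E.S e) := by
        refine Finset.sum_bij (fun e _ => e.1) (fun e he => ?_) (fun _ _ _ _ h => Subtype.ext h)
          (fun e he => ?_) fun _ _ => rfl
        · exact Finset.mem_filter.2 ⟨mem_out.2 (congrArg Subtype.val (mem_out.1 he)), e.2⟩
        · rw [Finset.mem_filter] at he
          exact ⟨⟨e, he.2⟩, mem_out.2 (Subtype.ext (mem_out.1 he.1)), rfl⟩
      have hm : ∑ e ∈ E.out v.1 with ¬ E.rng e ∉ H.carrier, E.S e * star (E.S e) ∈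
          idealSubalgebra H.carrier := by
        refine sum_mem fun e he => ?_
        exact mul_mem_closedIdeal_right _ (S_mem_closedIdeal (not_not.1 (Finset.mem_filter.1 he).2))
      have h2 := Finset.sum_filter_add_sum_filter_not (E.out v.1) (fun e => E.rng e ∉ H.carrier)
        (fun e => E.S e * star (E.S e))
      rw [hE.ck2 v.1 hv'] at h2
      simp only [map_sub, map_sum, map_mul, map_star, preLift_preS, preLift_preP]
      rw [hsum, ← h2, sub_add_cancel_left]
      exact neg_mem hm

variable {H} in
/-- A vertex outside `H`, as a vertex of `E / H`. -/
def toQuotVert {v : E.Vert} (hv : v ∉ H.carrier) : (E.quotient H).Vert := ⟨v, hv⟩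

variable {H} in
/-- An edge with range outside `H`, as an edge of `E / H`. -/
def toQuotEdge {e : E.Edge} (he : E.rng e ∉ H.carrier) : (E.quotient H).Edge := ⟨e, he⟩

variable {H} in
theorem quotientMap_P {v : E.Vert} (hv : v ∉ H.carrier) :
    quotientMap H (E.P v) = (E.quotient H).P (toQuotVert hv) := (lift_P _ v).trans (dif_pos hv)

variable {H} in
theorem quotientMap_P_of_mem {v : E.Vert} (hv : v ∈ H.carrier) :
    quotientMap H (E.P v) = 0 := (lift_P _ v).trans (dif_neg (not_not.2 hv))

variable {H} in
theorem quotientMap_S {e : E.Edge} (he : E.rng e ∉ H.carrier) :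
    quotientMap H (E.S e) = (E.quotient H).S (toQuotEdge he) := (lift_S _ e).trans (dif_pos he)

variable {H} in
theorem quotientMap_S_of_mem {e : E.Edge} (he : E.rng e ∈ H.carrier) :
    quotientMap H (E.S e) = 0 := (lift_S _ e).trans (dif_neg (not_not.2 he))

/-- Deleting the generators that belong to `H` from a polynomial changes it only by an element of
the ideal, and the remaining polynomial represents its image in C*(E/H). -/
theorem exists_preAlg_quotient (x : E.PreAlg) : ∃ y : (E.quotient H).PreAlg,
    of x - liftQuot H y ∈ idealSubalgebra H.carrier ∧ quotientMap H (of x) = of y := by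
  induction x using preAlg_induction with
  | preP v =>
    by_cases hv : v ∈ H.carrier
    · refine ⟨0, ?_, ?_⟩
      · rw [map_zero, sub_zero]
        exact P_mem_closedIdeal hv
      · rw [map_zero]
        exact quotientMap_P_of_mem hv
    · refine ⟨(E.quotient H).preP (toQuotVert hv), ?_, quotientMap_P hv⟩
      rw [liftQuot_preP]
      change E.P v - E.P v ∈ _
      rw [sub_self]
      exact zero_mem _
  | preS e =>
    by_cases he : E.rng e ∈ H.carrier
    · refine ⟨0, ?_, ?_⟩
      · rw [map_zero, sub_zero]
        exact S_mem_closedIdeal he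
      · rw [map_zero]
        exact quotientMap_S_of_mem he
    · refine ⟨(E.quotient H).preS (toQuotEdge he), ?_, quotientMap_S he⟩
      rw [liftQuot_preS]
      change E.S e - E.S e ∈ _
      rw [sub_self]
      exact zero_mem _
  | zero => exact ⟨0, by simp, by simp⟩
  | add x y hx hy =>
    obtain ⟨x', hx, hx'⟩ := hx
    obtain ⟨y', hy, hy'⟩ := hy
    refine ⟨x' + y', ?_, by simp [hx', hy']⟩
    rw [map_add, map_add, add_sub_add_comm]
    exact add_mem hx hy
  | mul x y hx hy =>
    obtain ⟨x', hx, hx'⟩ := hx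
    obtain ⟨y', hy, hy'⟩ := hy
    refine ⟨x' * y', ?_, by simp [hx', hy']⟩
    have : of (x * y) - liftQuot H (x' * y') =
        of x * (of y - liftQuot H y') + (of x - liftQuot H x') * liftQuot H y' := by
      rw [map_mul, map_mul]
      noncomm_ring
    rw [this]
    exact add_mem (mul_mem_closedIdeal_left _ hy) (mul_mem_closedIdeal_right _ hx)
  | smul c x hx =>
    obtain ⟨x', hx, hx'⟩ := hx
    refine ⟨c • x', ?_, by rw [map_smul, map_smul, hx', map_smul]⟩
    rw [map_smul, map_smul, ← smul_sub]
    exact SMulMemClass.smul_mem c hx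
  | hstar x hx =>
    obtain ⟨x', hx, hx'⟩ := hx
    refine ⟨star x', ?_, by rw [map_star, map_star, hx', map_star]⟩
    rw [map_star, map_star, ← star_sub]
    exact star_mem hx

/-- The estimate behind exactness. On polynomials it is the maximality of the universal seminorm of
E/H, applied to the distance seminorm; density gives the rest. -/
theorem distSeminorm_le_norm_quotientMap (a : E.CStar) :
    distSeminorm (idealSubalgebra H.carrier) a ≤ ‖quotientMap H a‖ := by
  induction a using denseRange_of.induction_on with
  | hp => exact isClosed_le (continuous_distSeminorm _) (continuous_hom _).norm
  | ih x =>
    obtain ⟨y, hy, hxy⟩ := exists_preAlg_quotient H x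
    rw [hxy, norm_of]
    refine le_trans ?_ (le_universalSeminorm (isCKSeminorm_quotSeminorm H) y)
    rw [quotSeminorm_apply]
    have := map_add_le_add (distSeminorm (idealSubalgebra H.carrier)) (of x - liftQuot H y)
      (liftQuot H y)
    rwa [sub_add_cancel, distSeminorm_eq_zero_of_mem hy, zero_add] at this

theorem quotientMap_eq_zero {x : E.CStar} (hx : x ∈ E.closedIdeal H.carrier) :
    quotientMap H x = 0 := by
  refine closedIdeal_induction (p := fun x => quotientMap H x = 0) ?_ ?_ ?_ ?_ ?_ ?_ ?_ hx
  · exact isClosed_eq (continuous_hom _) continuous_const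
  · intro v hv
    exact quotientMap_P_of_mem hv
  · exact map_zero _
  · intro x y hx hy
    rw [map_add, hx, hy, add_zero]
  · intro x hx
    rw [map_neg, hx, neg_zero]
  · intro a x hx
    rw [map_mul, hx, mul_zero]
  · intro a x hx
    rw [map_mul, hx, zero_mul]

/-- The range contains the generators, so it is dense. Preimages of controlled norm on the range
extend, by completeness, to its closure. -/
theorem surjective_quotientMap : Function.Surjective (quotientMap H) := by
  let f : NormedAddGroupHom E.CStar (E.quotient H).CStar :=
    { toFun := quotientMap H
      map_add' := map_add _
      bound' := ⟨1, fun x => by simpa using NonUnitalStarAlgHom.norm_apply_le (quotientMap H) x⟩ }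
  -- Any constant above 1 would serve: the distance to the ideal need not be attained, and the slack
  -- provides the strict inequality needed to choose `j`. At f a = 0 there is no slack, hence the
  -- separate case.
  have hf : f.SurjectiveOnWith f.range 2 := by
    rintro _ ⟨a, rfl⟩
    by_cases h0 : f a = 0
    · exact ⟨0, by rw [map_zero]; exact h0.symm, by simp⟩
    · have h1 : distSeminorm (idealSubalgebra H.carrier) a < 2 * ‖f a‖ := by
        have h2 : distSeminorm (idealSubalgebra H.carrier) a ≤ ‖f a‖ :=
          distSeminorm_le_norm_quotientMap H a
        have := norm_pos_iff.2 h0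
        linarith
      obtain ⟨j, hj, hr⟩ := exists_of_distSeminorm_lt h1
      refine ⟨a - j, ?_, hr.le⟩
      have : f j = 0 := quotientMap_eq_zero H hj
      rw [map_sub, this, sub_zero]
      rfl
  have hc := controlled_closure_of_complete (by norm_num) one_pos hf
  intro y
  have hy : y ∈ f.range.topologicalClosure := by
    let B : NonUnitalStarSubalgebra ℂ (E.quotient H).CStar :=
      (NonUnitalStarAlgHom.range (quotientMap H)).topologicalClosure
    refine mem_of_isClosed B (NonUnitalStarSubalgebra.isClosed_topologicalClosure _) (fun v => ?_)
      (fun e => ?_) y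
    · exact subset_closure ⟨E.P v.1, quotientMap_P v.2⟩
    · exact subset_closure ⟨E.S e.1, quotientMap_S e.2⟩
  obtain ⟨x, hx, -⟩ := hc y hy
  exact ⟨x, hx⟩

theorem isQuotientBy_quotientMap : IsQuotientBy (quotientMap H) (E.closedIdeal H.carrier) := by
  refine ⟨surjective_quotientMap H, fun x => ⟨fun hx => ?_, quotientMap_eq_zero H⟩⟩
  refine mem_of_distSeminorm_eq_zero isClosed_idealSubalgebra (le_antisymm ?_ (apply_nonneg _ _))
  simpa [hx] using distSeminorm_le_norm_quotientMap H x

end Exact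

end RowFiniteGraph

end

/-! ### The algebra of a single loop, and ideals generated by sinks. -/

noncomputable section

/-- An injective `*`-homomorphism of C*-algebras is isometric, so its range is closed. The unit has
to be placed in the range by hand, because the domain is not assumed unital. -/
theorem StarAlgebra.elemental_subset_range {A B : Type*} [NonUnitalCStarAlgebra A] [CStarAlgebra B]
    {f : A →⋆ₙₐ[ℂ] B} (hf : Function.Injective f) {x : B} (hx : x ∈ Set.range f)
    (h1 : 1 ∈ Set.range f) : (StarAlgebra.elemental ℂ x : Set B) ⊆ Set.range f := by
  have hc : IsClosed (Set.range f) :=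
    (NonUnitalStarAlgHom.isometry f hf).isClosedEmbedding.isClosed_range
  intro y hy
  induction hy using StarAlgebra.elemental.induction_on with
  | self => exact hx
  | star_self =>
    obtain ⟨a, rfl⟩ := hx
    exact ⟨star a, map_star f a⟩
  | algebraMap r =>
    obtain ⟨a, ha⟩ := h1
    exact ⟨r • a, by rw [map_smul, ha, Algebra.algebraMap_eq_smul_one]⟩
  | add u _ v _ hu hv =>
    obtain ⟨a, rfl⟩ := hu
    obtain ⟨b, rfl⟩ := hv
    exact ⟨a + b, map_add f a b⟩
  | mul u _ v _ hu hv =>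
    obtain ⟨a, rfl⟩ := hu
    obtain ⟨b, rfl⟩ := hv
    exact ⟨a * b, map_mul f a b⟩
  | closure s _ h v hv => exact closure_minimal h hc hv

namespace Toeplitz

theorem star_u_mul_u : star u * u = 1 := by
  ext z
  change star (z : ℂ) * z = 1
  rw [← starRingEnd_apply, ← Circle.coe_inv_eq_conj, ← Circle.coe_mul, inv_mul_cancel,
    Circle.coe_one]

theorem u_mul_star_u : u * star u = 1 := by rw [mul_comm, star_u_mul_u]

/-- Stone–Weierstrass: the inclusion of the circle into ℂ separates points by itself. -/
theorem elemental_u : StarAlgebra.elemental ℂ u = ⊤ := by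
  refine ContinuousMap.starSubalgebra_topologicalClosure_eq_top_of_separatesPoints _ ?_
  intro z w hzw
  exact ⟨u, ⟨u, StarAlgebra.self_mem_adjoin_singleton ℂ u, rfl⟩, fun h => hzw (Circle.ext h)⟩

end Toeplitz

namespace RowFiniteGraph

open GraphCStar

variable {E : RowFiniteGraph}

/-! ### The graph with one vertex and one loop -/

section Loop

variable {v : E.Vert} {e : E.Edge} (hv : ∀ w, w = v) (he : ∀ f, f = e)

include hv he in
theorem isCuntzKrieger_loop :
    E.IsCuntzKrieger (fun _ => (1 : C(Circle, ℂ))) (fun _ => Toeplitz.u) where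
  star_P _ := star_one _
  P_mul_self _ := one_mul _
  P_mul_P w w' h := absurd ((hv w).trans (hv w').symm) h
  partial_isometry _ := by rw [Toeplitz.u_mul_star_u, one_mul]
  ck1 _ := Toeplitz.star_u_mul_u
  ck2 w _ := by
    have h : E.out w = {e} := by
      ext f
      rw [mem_out, he f, hv w, hv (E.src e)]
      simp
    rw [h, Finset.sum_singleton, Toeplitz.u_mul_star_u]

/-- The `*`-homomorphism `C*(E) → C(S¹)` for the graph `E` with one vertex and one loop. -/
def loopHom : E.CStar →⋆ₙₐ[ℂ] C(Circle, ℂ) := lift _ _ (isCuntzKrieger_loop hv he)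

include hv in
-- The only vertex projection serves as the unit of C*(E), whose type carries none.
theorem P_mul_of_loop (x : E.CStar) : E.P v * x = x ∧ x * E.P v = x := by
  have hE := E.isCuntzKrieger
  let B : NonUnitalStarSubalgebra ℂ E.CStar :=
    { carrier := {x | E.P v * x = x ∧ x * E.P v = x}
      add_mem' := fun {x y} hx hy => ⟨by rw [mul_add, hx.1, hy.1], by rw [add_mul, hx.2, hy.2]⟩
      zero_mem' := ⟨mul_zero _, zero_mul _⟩
      mul_mem' := fun {x y} hx hy => ⟨by rw [← mul_assoc, hx.1], by rw [mul_assoc, hy.2]⟩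
      smul_mem' := fun c x hx => ⟨by rw [mul_smul_comm, hx.1], by rw [smul_mul_assoc, hx.2]⟩
      star_mem' := fun {x} hx =>
        ⟨by rw [← hE.star_P, ← star_mul, hx.2], by rw [← hE.star_P, ← star_mul, hx.1]⟩ }
  refine mem_of_isClosed B ?_ (fun w => ?_) (fun f => ⟨?_, ?_⟩) x
  · exact (isClosed_eq (by fun_prop) (by fun_prop)).inter (isClosed_eq (by fun_prop) (by fun_prop))
  · rw [hv w]
    exact ⟨hE.P_mul_self v, hE.P_mul_self v⟩
  · rw [← hv (E.src f), P_src_mul_S]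
  · rw [← hv (E.rng f), S_mul_P]

theorem loopHom_P (w : E.Vert) : loopHom hv he (E.P w) = 1 := lift_P _ w

theorem loopHom_S (f : E.Edge) : loopHom hv he (E.S f) = Toeplitz.u := lift_S _ f

/-- A left inverse is built by functional calculus. The partial isometry S_e is a unitary of the
corner P_v; filled up by 1 - P_v it becomes a unitary of the unitization, which yields a
homomorphism ψ out of C(S¹). Cutting ψ down by P_v recovers every element from its image. -/
theorem injective_loopHom : Function.Injective (loopHom hv he) := by
  have hE := E.isCuntzKrieger
  let U := Unitization ℂ E.CStar
  let p : U := (E.P v : E.CStar)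
  let t : U := (E.S e : E.CStar)
  have hp : star p = p := by rw [← Unitization.inr_star, hE.star_P]
  have hpp : p * p = p := by rw [← Unitization.inr_mul, hE.P_mul_self]
  have hpt : p * t = t := by rw [← Unitization.inr_mul, (P_mul_of_loop hv _).1]
  have htp : t * p = t := by rw [← Unitization.inr_mul, (P_mul_of_loop hv _).2]
  have hpt' : p * star t = star t := by
    rw [← Unitization.inr_star, ← Unitization.inr_mul, (P_mul_of_loop hv _).1]
  have htp' : star t * p = star t := by
    rw [← Unitization.inr_star, ← Unitization.inr_mul, (P_mul_of_loop hv _).2]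
  have h1 : star t * t = p := by
    rw [← Unitization.inr_star, ← Unitization.inr_mul, hE.ck1, hv (E.rng e)]
  have h2 : t * star t = p := by
    have h := hE.ck2 v fun hs => hs e (hv _)
    have ho : E.out v = {e} := by
      ext f
      rw [mem_out, he f, hv (E.src e)]
      simp
    rw [ho, Finset.sum_singleton] at h
    rw [← Unitization.inr_star, ← Unitization.inr_mul, h]
  let T : U := t + (1 - p)
  have hT : T ∈ unitary U := by
    have h0 : star (1 : U) = 1 := star_one U
    rw [Unitary.mem_iff]
    simp only [T, star_add, star_sub, h0, hp, mul_add, add_mul, mul_sub, sub_mul, mul_one,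
      one_mul, h1, h2, hpp, hpt, htp, hpt', htp']
    constructor <;> abel
  have hTn : IsStarNormal T := ⟨hT.1.trans hT.2.symm⟩
  -- The spectrum of a unitary lies on the circle, so functions on the circle can be restricted to
  -- it before the functional calculus is applied.
  let i : C(spectrum ℂ T, Circle) := ⟨fun z => ⟨z, by
    rw [← SetLike.mem_coe, Submonoid.coe_unitSphere]
    exact spectrum.subset_circle_of_unitary hT z.2⟩, by fun_prop⟩
  let ψ : C(Circle, ℂ) →⋆ₐ[ℂ] U := (cfcHom hTn).comp (i.compStarAlgHom' ℂ ℂ)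
  have hψ : ψ Toeplitz.u = T := cfcHom_id hTn
  let f := loopHom hv he
  -- The identity is imposed with p on either side because the adjoint exchanges the two sides.
  let B : NonUnitalStarSubalgebra ℂ E.CStar :=
    { carrier := {x | p * ψ (f x) = (x : U) ∧ ψ (f x) * p = (x : U)}
      add_mem' := fun {x y} hx hy => ⟨by
        rw [map_add, map_add, mul_add, hx.1, hy.1, Unitization.inr_add], by
        rw [map_add, map_add, add_mul, hx.2, hy.2, Unitization.inr_add]⟩
      zero_mem' := by simp
      mul_mem' := fun {x y} hx hy => by
        have hxp : (x : U) * p = x := by rw [← Unitization.inr_mul, (P_mul_of_loop hv _).2]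
        have hpy : p * (y : U) = y := by rw [← Unitization.inr_mul, (P_mul_of_loop hv _).1]
        constructor
        · rw [map_mul, map_mul, ← mul_assoc, hx.1, Unitization.inr_mul, ← hy.1, ← mul_assoc, hxp]
        · rw [map_mul, map_mul, mul_assoc, hy.2, Unitization.inr_mul, ← hx.2, mul_assoc, hpy]
      smul_mem' := fun c x hx => ⟨by
        rw [map_smul, map_smul, mul_smul_comm, hx.1, Unitization.inr_smul], by
        rw [map_smul, map_smul, smul_mul_assoc, hx.2, Unitization.inr_smul]⟩
      star_mem' := fun {x} hx => ⟨by
        rw [map_star, map_star, ← hp, ← star_mul, hx.2, Unitization.inr_star], by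
        rw [map_star, map_star, ← hp, ← star_mul, hx.1, Unitization.inr_star]⟩ }
  have hf : Continuous fun x => ψ (f x) :=
    ((cfcHom_continuous hTn).comp (ContinuousMap.continuous_precomp i)).comp (continuous_hom f)
  have hi : Continuous fun x : E.CStar => (x : U) :=
    (Unitization.isometry_inr (𝕜 := ℂ) (A := E.CStar)).continuous
  have hB (x : E.CStar) : x ∈ B := by
    refine mem_of_isClosed B ?_ (fun w => ?_) (fun g => ?_) x
    · exact (isClosed_eq (continuous_const.mul hf) hi).inter
        (isClosed_eq (hf.mul continuous_const) hi)
    · change p * ψ (f _) = _ ∧ ψ (f _) * p = _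
      rw [loopHom_P, map_one, mul_one, one_mul, hv w]
      exact ⟨rfl, rfl⟩
    · change p * ψ (f _) = _ ∧ ψ (f _) * p = _
      rw [loopHom_S, hψ, he g, mul_add, add_mul, mul_sub, sub_mul, hpt, htp, hpp, mul_one, one_mul,
        sub_self, add_zero]
      exact ⟨rfl, rfl⟩
  refine (injective_iff_map_eq_zero _).2 fun x hx => ?_
  have h := (hB x).1
  rw [show f x = 0 from hx, map_zero, mul_zero] at h
  exact Unitization.inr_injective (R := ℂ) (h.symm.trans (Unitization.inr_zero ℂ).symm)

theorem bijective_loopHom : Function.Bijective (loopHom hv he) := by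
  refine ⟨injective_loopHom hv he, fun f => ?_⟩
  refine StarAlgebra.elemental_subset_range (injective_loopHom hv he) (x := Toeplitz.u)
    ⟨E.S e, loopHom_S hv he e⟩ ⟨E.P v, loopHom_P hv he v⟩ ?_
  rw [Toeplitz.elemental_u]
  trivial

/-- The C*-algebra of the graph with one vertex and one loop is `C(S¹)`. -/
def loopEquiv : E.CStar ≃⋆ₐ[ℂ] C(Circle, ℂ) := StarAlgEquiv.ofBijective _ (bijective_loopHom hv he)

end Loop

/-! ### Paths to a sink -/

section Sink

/-- `x` is the partial isometry of a path from `v` to `w`. -/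
inductive IsPathElt (w : E.Vert) : E.Vert → E.CStar → Prop
  | nil : IsPathElt w w (E.P w)
  | cons (e : E.Edge) (x : E.CStar) (h : IsPathElt w (E.rng e) x) :
      IsPathElt w (E.src e) (E.S e * x)

variable {w : E.Vert}

theorem IsPathElt.P_mul {v : E.Vert} {x : E.CStar} (h : IsPathElt w v x) : E.P v * x = x := by
  cases h with
  | nil => exact E.isCuntzKrieger.P_mul_self w
  | cons e x h => rw [← mul_assoc, P_src_mul_S]

theorem IsPathElt.P_mul_of_ne {v v' : E.Vert} {x : E.CStar} (h : IsPathElt w v x) (hv : v' ≠ v) :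
    E.P v' * x = 0 := by
  rw [← h.P_mul, ← mul_assoc, E.isCuntzKrieger.P_mul_P _ _ hv, zero_mul]

theorem IsPathElt.reachable {v : E.Vert} {x : E.CStar} (h : IsPathElt w v x) :
    E.Reachable v w := by
  induction h with
  | nil => exact .refl
  | cons e x _ ih => exact .head ⟨e, rfl, rfl⟩ ih

variable (w) in
/-- The closed linear span of the partial isometries of the paths that end in `w`. -/
def pathSpan : Submodule ℂ E.CStar :=
  (Submodule.span ℂ {x | ∃ v, IsPathElt w v x}).topologicalClosure

theorem mul_mem_pathSpan_of_path {a : E.CStar} (h : ∀ v x, IsPathElt w v x →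
    a * x ∈ Submodule.span ℂ {x | ∃ v, IsPathElt w v x}) {x : E.CStar} (hx : x ∈ pathSpan w) :
    a * x ∈ pathSpan w := by
  refine map_mem_closure (continuous_const_mul a) hx fun y hy => ?_
  induction hy using Submodule.span_induction with
  | mem y hy =>
    obtain ⟨v, hv⟩ := hy
    exact h v y hv
  | zero => rw [mul_zero]; exact zero_mem (Submodule.span ℂ _)
  | add y z _ _ hy hz => rw [mul_add]; exact add_mem (S := Submodule ℂ E.CStar) hy hz
  | smul c y _ hy => rw [mul_smul_comm]; exact Submodule.smul_mem _ c hy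

/-- Left multiplication by a generator sends a path ending in `w` to such a path or to zero: P_v
fixes or kills it, S_e prepends an edge, and S_e* removes the first edge. The only path without a
first edge is P_w, and S_e* P_w = 0 because the sink emits no edge. -/
theorem mul_mem_pathSpan (hw : E.IsSink w) (a : E.CStar) {x : E.CStar} (hx : x ∈ pathSpan w) :
    a * x ∈ pathSpan w := by
  have hE := E.isCuntzKrieger
  -- The span is only a left ideal, so the condition on the adjoint is built in to obtain a
  -- `*`-subalgebra.
  let B : NonUnitalStarSubalgebra ℂ E.CStar :=
    { carrier := {a | ∀ x ∈ pathSpan w, a * x ∈ pathSpan w ∧ star a * x ∈ pathSpan w}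
      add_mem' := fun {a b} ha hb x hx => by
        rw [star_add, add_mul, add_mul]
        exact ⟨add_mem (ha x hx).1 (hb x hx).1, add_mem (ha x hx).2 (hb x hx).2⟩
      zero_mem' := fun x _ => by
        rw [star_zero, zero_mul]
        exact ⟨zero_mem _, zero_mem _⟩
      mul_mem' := fun {a b} ha hb x hx => by
        rw [star_mul, mul_assoc, mul_assoc]
        exact ⟨(ha _ (hb x hx).1).1, (hb _ (ha x hx).2).2⟩
      smul_mem' := fun c a ha x hx => by
        rw [star_smul, smul_mul_assoc, smul_mul_assoc]
        exact ⟨Submodule.smul_mem _ _ (ha x hx).1, Submodule.smul_mem _ _ (ha x hx).2⟩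
      star_mem' := fun {a} ha x hx => by
        rw [star_star]
        exact (ha x hx).symm }
  have hX : IsClosed (pathSpan w : Set E.CStar) := Submodule.isClosed_topologicalClosure _
  refine (mem_of_isClosed B ?_ (fun v => ?_) (fun e => ?_) a x hx).1
  · have : (B : Set E.CStar) = ⋂ x ∈ pathSpan w, ((fun a => a * x) ⁻¹' (pathSpan w)) ∩
        ((fun a => star a * x) ⁻¹' (pathSpan w)) := by
      ext a
      simp only [Set.mem_iInter]
      rfl
    rw [this]
    exact isClosed_biInter fun x _ => (hX.preimage (by fun_prop)).inter
      (hX.preimage (by fun_prop))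
  · have h (x) (hx : x ∈ pathSpan w) : E.P v * x ∈ pathSpan w := by
      refine mul_mem_pathSpan_of_path (fun v' y hy => ?_) hx
      by_cases hv : v = v'
      · rw [hv, hy.P_mul]
        exact Submodule.subset_span ⟨v', hy⟩
      · rw [hy.P_mul_of_ne hv]
        exact zero_mem _
    refine fun x hx => ⟨h x hx, ?_⟩
    rw [hE.star_P]
    exact h x hx
  · refine fun x hx => ⟨mul_mem_pathSpan_of_path (fun v' y hy => ?_) hx,
      mul_mem_pathSpan_of_path (fun v' y hy => ?_) hx⟩
    · by_cases hv : E.rng e = v'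
      · subst hv
        exact Submodule.subset_span ⟨_, .cons e y hy⟩
      · rw [← S_mul_P, mul_assoc, hy.P_mul_of_ne hv, mul_zero]
        exact zero_mem _
    · cases hy with
      | nil =>
        rw [← star_S_mul_P_src, mul_assoc, hE.P_mul_P _ _ (hw e), mul_zero]
        exact zero_mem _
      | cons f y hy =>
        by_cases hef : e = f
        · subst hef
          rw [← mul_assoc, hE.ck1, hy.P_mul]
          exact Submodule.subset_span ⟨_, hy⟩
        · rw [← mul_assoc, star_S_mul_S_of_ne hef, zero_mul]
          exact zero_mem _

theorem mul_P_mem_pathSpan (hw : E.IsSink w) (a : E.CStar) : a * E.P w ∈ pathSpan w :=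
  mul_mem_pathSpan hw a (Submodule.le_topologicalClosure _ (Submodule.subset_span ⟨w, .nil⟩))

theorem pathSpan_induction {p : E.CStar → Prop} (hc : IsClosed {x | p x})
    (path : ∀ v x, IsPathElt w v x → p x) (zero : p 0) (add : ∀ x y, p x → p y → p (x + y))
    (smul : ∀ (c : ℂ) x, p x → p (c • x)) {x : E.CStar} (hx : x ∈ pathSpan w) : p x := by
  refine closure_minimal (fun y hy => ?_) hc hx
  induction hy using Submodule.span_induction with
  | mem y hy =>
    obtain ⟨v, hv⟩ := hy
    exact path v y hv
  | zero => exact zero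
  | add y z _ _ hy hz => exact add y z hy hz
  | smul c y _ hy => exact smul c y hy

/-- The element a P_w is a limit of combinations of paths into `w`, and none of these paths starts
at `v`. -/
theorem P_mul_mul_P_eq_zero (hw : E.IsSink w) {v : E.Vert} (hv : ¬ E.Reachable v w)
    (a : E.CStar) : E.P v * a * E.P w = 0 := by
  rw [mul_assoc]
  refine pathSpan_induction (p := fun x => E.P v * x = 0)
    (isClosed_eq (by fun_prop) (by fun_prop)) (fun v' x hx => ?_) (mul_zero _)
    (fun x y hx hy => ?_) (fun c x hx => ?_) (mul_P_mem_pathSpan hw a)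
  · exact hx.P_mul_of_ne fun h => hv (h ▸ hx.reachable)
  · rw [mul_add, hx, hy, add_zero]
  · rw [mul_smul_comm, hx, smul_zero]

/-- The corner of a sink is one-dimensional. -/
theorem exists_P_mul_mul_P (hw : E.IsSink w) (a : E.CStar) :
    ∃ c : ℂ, E.P w * a * E.P w = c • E.P w := by
  -- Among the paths that end in the sink, only the trivial one also starts there. The line is
  -- closed because it is finite-dimensional.
  have h : E.P w * (a * E.P w) ∈ Submodule.span ℂ {E.P w} := by
    refine pathSpan_induction (p := fun x => E.P w * x ∈ Submodule.span ℂ {E.P w})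
      ?_ (fun v' x hx => ?_) ?_ (fun x y hx hy => ?_) (fun c x hx => ?_) (mul_P_mem_pathSpan hw a)
    · exact (Submodule.closed_of_finiteDimensional (Submodule.span ℂ {E.P w})).preimage
        (continuous_const_mul _)
    · cases hx with
      | nil =>
        rw [E.isCuntzKrieger.P_mul_self]
        exact Submodule.mem_span_singleton_self _
      | cons f y hy =>
        rw [(IsPathElt.cons f y hy).P_mul_of_ne (hw f).symm]
        exact zero_mem _
    · rw [mul_zero]
      exact zero_mem _
    · rw [mul_add]
      exact add_mem hx hy
    · rw [mul_smul_comm]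
      exact Submodule.smul_mem _ c hx
  obtain ⟨c, hc⟩ := Submodule.mem_span_singleton.1 h
  exact ⟨c, by rw [mul_assoc, hc]⟩

/-- The quantifier over the middle factor makes the condition stable under multiplication of `x`
from the right, so it passes from the generating projections to the closed ideal. -/
theorem mul_mul_eq_zero_of_left {H : Set E.Vert} {y : E.CStar}
    (h : ∀ v ∈ H, ∀ a, E.P v * a * y = 0) {x : E.CStar} (hx : x ∈ E.closedIdeal H) :
    ∀ a, x * a * y = 0 := by
  refine closedIdeal_induction (p := fun x => ∀ a, x * a * y = 0) ?_ h ?_ ?_ ?_ ?_ ?_ hx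
  · have : {x : E.CStar | ∀ a, x * a * y = 0} = ⋂ a, {x | x * a * y = 0} := by
      ext x
      simp only [Set.mem_iInter]
      rfl
    rw [this]
    exact isClosed_iInter fun a => isClosed_eq
      ((continuous_id.mul continuous_const).mul continuous_const) continuous_const
  · intro a
    rw [zero_mul, zero_mul]
  · intro z z' hz hz' a
    rw [add_mul, add_mul, hz, hz', add_zero]
  · intro z hz a
    rw [neg_mul, neg_mul, hz, neg_zero]
  · intro b z hz a
    rw [mul_assoc b, mul_assoc b, hz, mul_zero]
  · intro b z hz a
    rw [mul_assoc z, hz]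

theorem mul_mul_eq_zero_of_right {H : Set E.Vert} {y : E.CStar}
    (h : ∀ v ∈ H, ∀ a, y * a * E.P v = 0) {x : E.CStar} (hx : x ∈ E.closedIdeal H) (a : E.CStar) :
    y * a * x = 0 := by
  have h1 (v) (hv : v ∈ H) (b : E.CStar) : E.P v * b * star y = 0 := by
    have := congrArg star (h v hv (star b))
    rwa [star_mul, star_mul, star_star, E.isCuntzKrieger.star_P, star_zero, ← mul_assoc] at this
  have := congrArg star (mul_mul_eq_zero_of_left h1 (star_mem_closedIdeal hx) (star a))
  rwa [star_mul, star_mul, star_star, star_star, star_star, star_zero, ← mul_assoc] at this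

/-- Simplicity of the ideal of a sink, in the form needed for faithfulness. If f kills x, then P_w a
x b P_w is a multiple of P_w that f kills, so it is zero. Hence y a x b z = 0 for all y, z in the
ideal, and suitable factors give a vanishing power of x*x. -/
theorem eq_zero_of_mem_closedIdeal_sink (hw : E.IsSink w) {B : Type*} [NonUnitalCStarAlgebra B]
    {f : E.CStar →⋆ₙₐ[ℂ] B} (hf : f (E.P w) ≠ 0) {x : E.CStar} (hx : x ∈ E.closedIdeal {w})
    (hfx : f x = 0) : x = 0 := by
  have h1 (a b : E.CStar) : E.P w * a * x * b * E.P w = 0 := by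
    obtain ⟨c, hc⟩ := exists_P_mul_mul_P hw (a * x * b)
    have h : c • f (E.P w) = 0 := by
      rw [← map_smul, ← hc]
      simp [hfx]
    have hc0 : c = 0 := (smul_eq_zero.1 h).resolve_right hf
    rw [hc0, zero_smul] at hc
    simpa [mul_assoc] using hc
  have h2 {y z : E.CStar} (hy : y ∈ E.closedIdeal {w}) (hz : z ∈ E.closedIdeal {w})
      (a b : E.CStar) : y * a * (x * b * z) = 0 := by
    refine mul_mul_eq_zero_of_left (fun v hv a => ?_) hy a
    obtain rfl : v = w := hv
    have := mul_mul_eq_zero_of_right (y := E.P v * a * x) (fun u hu b => ?_) hz b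
    · simpa only [mul_assoc] using this
    · obtain rfl : u = v := hu
      exact h1 a b
  -- This is (x*x)⁴ = 0; the outer factors y = z = x* lie in the ideal. The C*-identity then halves
  -- the exponent until x = 0.
  have h4 : star (star x * x * (star x * x)) * (star x * x * (star x * x)) = 0 := by
    have := h2 (star_mem_closedIdeal hx) (star_mem_closedIdeal hx) (x * star x) (star x * x)
    have := congrArg (· * x) this
    simpa [mul_assoc] using this
  have h5 : star (star x * x) * (star x * x) = 0 := by
    rw [star_mul, star_star]
    exact (CStarRing.star_mul_self_eq_zero_iff _).1 h4
  exact (CStarRing.star_mul_self_eq_zero_iff _).1 ((CStarRing.star_mul_self_eq_zero_iff _).1 h5)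

/-- All products x a y vanish, but there is no unit to put in place of a. The choice a = y (xy)* x
gives ((xy)*(xy))² = 0 instead. -/
theorem mul_eq_zero_of_mem_closedIdeal {H K : Set E.Vert}
    (h : ∀ v ∈ H, ∀ w ∈ K, ∀ a, E.P v * a * E.P w = 0) {x y : E.CStar}
    (hx : x ∈ E.closedIdeal H) (hy : y ∈ E.closedIdeal K) : x * y = 0 := by
  have h1 : ∀ a, x * a * y = 0 :=
    mul_mul_eq_zero_of_left (fun v hv => mul_mul_eq_zero_of_right (h v hv) hy) hx
  have h2 : star (star (x * y) * (x * y)) * (star (x * y) * (x * y)) = 0 := by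
    have := congrArg (star (x * y) * ·) (h1 (y * star (x * y) * x))
    simpa [mul_assoc] using this
  exact (CStarRing.star_mul_self_eq_zero_iff _).1 ((CStarRing.star_mul_self_eq_zero_iff _).1 h2)

end Sink

end RowFiniteGraph

end

/-! ### Equivariance, orthogonal ideals, and the Toeplitz algebra as a graph algebra. -/

noncomputable section

namespace RowFiniteGraph

open GraphCStar

variable {E : RowFiniteGraph}

/-! ### Equivariance and isomorphisms of graphs -/

theorem hom_gauge {B : Type*} [NonUnitalCStarAlgebra B] {f : E.CStar →⋆ₙₐ[ℂ] B}
    {g : B →⋆ₙₐ[ℂ] B} {z : Circle} (hP : ∀ v, g (f (E.P v)) = f (E.P v))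
    (hS : ∀ e, g (f (E.S e)) = (z : ℂ) • f (E.S e)) (x : E.CStar) :
    f (E.gauge z x) = g (f x) := by
  have h : f.comp (E.gauge z) = g.comp f := by
    refine hom_ext (fun v => ?_) fun e => ?_
    · rw [NonUnitalStarAlgHom.comp_apply, NonUnitalStarAlgHom.comp_apply, hP, gauge, lift_P]
    · rw [NonUnitalStarAlgHom.comp_apply, NonUnitalStarAlgHom.comp_apply, hS, gauge, lift_S,
        map_smul]
  exact DFunLike.congr_fun h x

theorem gauge_P (z : Circle) (v : E.Vert) : E.gauge z (E.P v) = E.P v := lift_P _ v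

theorem gauge_S (z : Circle) (e : E.Edge) : E.gauge z (E.S e) = (z : ℂ) • E.S e := lift_S _ e

theorem quotientMap_gauge (H : E.SatHereditary) (z : Circle) (x : E.CStar) :
    quotientMap H (E.gauge z x) = (E.quotient H).gauge z (quotientMap H x) := by
  refine hom_gauge (fun v => ?_) (fun e => ?_) x
  · by_cases hv : v ∈ H.carrier
    · rw [quotientMap_P_of_mem hv, map_zero]
    · rw [quotientMap_P hv, gauge_P]
  · by_cases he : E.rng e ∈ H.carrier
    · rw [quotientMap_S_of_mem he, map_zero, smul_zero]
    · rw [quotientMap_S he, gauge_S]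

section Iso

variable {F : RowFiniteGraph} (i : Iso E F)

theorem Iso.map_P (v : E.Vert) : i.map (E.P v) = F.P (i.vert v) := lift_P _ v

theorem Iso.map_S (e : E.Edge) : i.map (E.S e) = F.S (i.edge e) := lift_S _ e

theorem Iso.map_gauge (z : Circle) (x : E.CStar) :
    i.map (E.gauge z x) = F.gauge z (i.map x) := by
  refine hom_gauge (fun v => ?_) (fun e => ?_) x
  · rw [i.map_P, gauge_P]
  · rw [i.map_S, gauge_S]

theorem Iso.symm_map_map (x : E.CStar) : i.symm.map (i.map x) = x := by
  have h : i.symm.map.comp i.map = NonUnitalStarAlgHom.id ℂ E.CStar := by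
    refine hom_ext (fun v => ?_) fun e => ?_
    · rw [NonUnitalStarAlgHom.comp_apply, i.map_P, i.symm.map_P]
      exact congrArg E.P (i.vert.symm_apply_apply v)
    · rw [NonUnitalStarAlgHom.comp_apply, i.map_S, i.symm.map_S]
      exact congrArg E.S (i.edge.symm_apply_apply e)
  exact DFunLike.congr_fun h x

theorem Iso.bijective_map : Function.Bijective i.map :=
  ⟨(Function.LeftInverse.injective i.symm_map_map),
    fun y => ⟨i.symm.map y, i.symm.symm_map_map y⟩⟩

end Iso

/-! ### Ideals with product zero -/

section Disjoint

variable {H : E.SatHereditary} {K : Set E.Vert}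
  (h : ∀ v ∈ H.carrier, ∀ w ∈ K, ∀ a, E.P v * a * E.P w = 0)

include h in
-- By exactness x lies in the ideal of `H`, while x* lies in the ideal of `K`; these ideals have
-- product zero, so x x* = 0.
theorem eq_zero_of_mem_inter {x : E.CStar} (hx : x ∈ E.closedIdeal K)
    (hx' : quotientMap H x = 0) : x = 0 :=
  CStarRing.mul_star_self_eq_zero_iff x |>.1 (mul_eq_zero_of_mem_closedIdeal h
    (((isQuotientBy_quotientMap H).2 x).1 hx') (star_mem_closedIdeal hx))

include h in
-- On the ideal of `K` the quotient map is injective, hence isometric with closed range. This range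
-- is an ideal, because the quotient map is surjective, and it contains the projections of `K'`.
theorem exists_mem_closedIdeal_quotientMap_eq {K' : Set (E.quotient H).Vert}
    (hK : ∀ w ∈ K', w.1 ∈ K) {y : (E.quotient H).CStar} (hy : y ∈ (E.quotient H).closedIdeal K') :
    ∃ x ∈ E.closedIdeal K, quotientMap H x = y := by
  have hcl : IsClosed (idealSubalgebra K : Set E.CStar) := isClosed_idealSubalgebra
  let f : idealSubalgebra K →⋆ₙₐ[ℂ] (E.quotient H).CStar :=
    (quotientMap H).comp (NonUnitalStarSubalgebraClass.subtype (idealSubalgebra K))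
  have hf : Function.Injective f := (injective_iff_map_eq_zero f).2 fun x hx =>
    Subtype.ext (eq_zero_of_mem_inter h x.2 hx)
  suffices hr : y ∈ Set.range f by
    obtain ⟨x, rfl⟩ := hr
    exact ⟨x, x.2, rfl⟩
  refine closedIdeal_induction (p := fun y => y ∈ Set.range f)
    (NonUnitalStarAlgHom.isometry f hf).isClosedEmbedding.isClosed_range (fun w hw => ?_)
    ⟨0, map_zero f⟩ ?_ ?_ ?_ ?_ hy
  · exact ⟨⟨E.P w.1, P_mem_closedIdeal (hK w hw)⟩, quotientMap_P w.2⟩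
  · rintro _ _ ⟨x, rfl⟩ ⟨x', rfl⟩
    exact ⟨x + x', map_add f x x'⟩
  · rintro _ ⟨x, rfl⟩
    exact ⟨-x, map_neg f x⟩
  · rintro b _ ⟨x, rfl⟩
    obtain ⟨a, rfl⟩ := surjective_quotientMap H b
    exact ⟨⟨a * x, mul_mem_closedIdeal_left a x.2⟩, map_mul (quotientMap H) a x.1⟩
  · rintro b _ ⟨x, rfl⟩
    obtain ⟨a, rfl⟩ := surjective_quotientMap H b
    exact ⟨⟨x * a, mul_mem_closedIdeal_right a x.2⟩, map_mul (quotientMap H) x.1 a⟩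

end Disjoint

end RowFiniteGraph

/-- The rotation of `C(S¹)` by `z`, as a `*`-homomorphism. -/
def circleRotationHom (z : Circle) : C(Circle, ℂ) →⋆ₐ[ℂ] C(Circle, ℂ) :=
  (⟨fun w => z * w, by fun_prop⟩ : C(Circle, Circle)).compStarAlgHom' ℂ ℂ

theorem circleRotationHom_u (z : Circle) :
    circleRotationHom z Toeplitz.u = (z : ℂ) • Toeplitz.u := by
  ext w
  exact Circle.coe_mul z w

theorem Toeplitz.star_s_mul_s : star s * s = 1 := Subtype.ext star_shift_mul_shift

-- The first basis vector is not in the range of the shift.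
set_option synthInstance.maxHeartbeats 400000 in
theorem Toeplitz.one_sub_s_mul_star_s_ne_zero : 1 - s * star s ≠ 0 := by
  intro h
  have h1 : 1 = shift * star shift := congrArg Subtype.val (sub_eq_zero.1 h)
  have h2 : basisVec 0 = shift (star shift (basisVec 0)) :=
    congrArg (fun x : L2 →L[ℂ] L2 => x (basisVec 0)) h1
  have h3 : basisVec 0 0 = shiftSeq (star shift (basisVec 0)) 0 :=
    congrArg (fun x : L2 => x 0) h2
  simp [basisVec, shiftSeq, lp.single_apply] at h3

namespace RowFiniteGraph

open Toeplitz

variable {E : RowFiniteGraph}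

theorem loopHom_gauge {v : E.Vert} {e : E.Edge} (hv : ∀ w, w = v) (he : ∀ f, f = e) (z : Circle)
    (x : E.CStar) : loopHom hv he (E.gauge z x) = circleRotation z (loopHom hv he x) := by
  refine hom_gauge (g := (circleRotationHom z : C(Circle, ℂ) →⋆ₙₐ[ℂ] C(Circle, ℂ)))
    (fun w => ?_) (fun f => ?_) x
  · rw [loopHom_P]
    exact map_one (circleRotationHom z)
  · rw [loopHom_S]
    exact circleRotationHom_u z

/-! ### The graph of the Toeplitz algebra -/

/-- `E` consists of a vertex `v` with a loop `e`, a sink `w`, and one edge `f` from `v` to `w`. -/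
structure IsToeplitzGraph (E : RowFiniteGraph) (v w : E.Vert) (e f : E.Edge) : Prop where
  ne : v ≠ w
  src_e : E.src e = v
  rng_e : E.rng e = v
  src_f : E.src f = v
  rng_f : E.rng f = w
  vert : ∀ u, u = v ∨ u = w
  edge : ∀ g, g = e ∨ g = f

namespace IsToeplitzGraph

variable {v w : E.Vert} {e f : E.Edge} (hE : IsToeplitzGraph E v w e f)

include hE

theorem src (g : E.Edge) : E.src g = v := by
  rcases hE.edge g with rfl | rfl
  · exact hE.src_e
  · exact hE.src_f

theorem isSink : E.IsSink w := fun g => by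
  rw [hE.src]
  exact hE.ne

theorem e_ne_f : e ≠ f := fun h => hE.ne (by rw [← hE.rng_e, ← hE.rng_f, h])

/-- The saturated hereditary set that consists of the sink. -/
def sink : E.SatHereditary where
  carrier := {w}
  hereditary := hereditary_of_edge fun g hg => absurd hg (hE.isSink g)
  saturated u hu h := by
    rcases hE.vert u with rfl | rfl
    · exact absurd (hE.rng_e.symm.trans (h e hE.src_e)) hE.ne
    · rfl

theorem notMem_sink : v ∉ hE.sink.carrier := hE.ne

theorem rng_notMem_sink : E.rng e ∉ hE.sink.carrier := by
  rw [hE.rng_e]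
  exact hE.ne

theorem quotient_vert (u : (E.quotient hE.sink).Vert) : u = toQuotVert hE.notMem_sink :=
  Subtype.ext ((hE.vert u.1).resolve_right u.2)

theorem quotient_edge (g : (E.quotient hE.sink).Edge) : g = toQuotEdge hE.rng_notMem_sink := by
  refine Subtype.ext ((hE.edge g.1).resolve_right fun h => g.2 ?_)
  rw [h]
  exact hE.rng_f

-- An isometry is cut into its restrictions to its own range and to the complement of that range.
-- For a projection q, the element sq is a partial isometry with initial projection q and final
-- projection s q s*; the final projections for q = ss* and q = 1 - ss* add up to ss*, which is
-- `ck2` at v.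
open Classical in
theorem isCuntzKrieger_isometry {B : Type*} [CStarAlgebra B] {s : B}
    (hs : star s * s = 1) : E.IsCuntzKrieger
    (fun u => if u = v then s * star s else 1 - s * star s)
    (fun g => if g = e then s * (s * star s) else s * (1 - s * star s)) := by
  have hq : s * star s * (s * star s) = s * star s := by
    rw [mul_assoc, ← mul_assoc (star s), hs, one_mul]
  have hq' : (1 - s * star s) * (1 - s * star s) = 1 - s * star s := by
    simp only [mul_sub, sub_mul, mul_one, one_mul, hq, sub_self, sub_zero]
  have hst : star (s * star s) = s * star s := by rw [star_mul, star_star]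
  have hst' : star (1 - s * star s) = 1 - s * star s := by rw [star_sub, star_one, hst]
  have hiso (q : B) (h1 : star q = q) (h2 : q * q = q) :
      star (s * q) * (s * q) = q := by
    rw [star_mul, h1, mul_assoc, ← mul_assoc (star s), hs, one_mul, h2]
  have hrng (q : B) (h1 : star q = q) (h2 : q * q = q) :
      s * q * star (s * q) = s * q * star s := by
    rw [star_mul, h1, mul_assoc s q, ← mul_assoc q q, h2, mul_assoc]
  refine ⟨fun u => ?_, fun u => ?_, fun u u' hu => ?_, fun g => ?_, fun g => ?_, fun u hu => ?_⟩
  · split_ifs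
    · exact hst
    · exact hst'
  · split_ifs
    · exact hq
    · exact hq'
  · split_ifs with h h' h'
    · exact absurd (h.trans h'.symm) hu
    · rw [mul_sub, mul_one, hq, sub_self]
    · rw [sub_mul, one_mul, hq, sub_self]
    · exact absurd (((hE.vert u).resolve_left h).trans ((hE.vert u').resolve_left h').symm) hu
  · split_ifs
    · rw [mul_assoc, hiso _ hst hq, mul_assoc, hq]
    · rw [mul_assoc, hiso _ hst' hq', mul_assoc, hq']
  · rcases hE.edge g with rfl | rfl
    · rw [if_pos rfl, if_pos hE.rng_e, hiso _ hst hq]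
    · rw [if_neg hE.e_ne_f.symm, if_neg (by rw [hE.rng_f]; exact hE.ne.symm), hiso _ hst' hq']
  · rcases hE.vert u with rfl | rfl
    · have ho : E.out u = {e, f} := by
        ext g
        rw [mem_out, hE.src, Finset.mem_insert, Finset.mem_singleton]
        exact iff_of_true rfl (hE.edge g)
      rw [ho, Finset.sum_pair hE.e_ne_f, if_pos rfl, if_neg hE.e_ne_f.symm, if_pos rfl,
        hrng _ hst hq, hrng _ hst' hq', ← add_mul, ← mul_add, add_sub_cancel, mul_one]
    · exact absurd hE.isSink hu

section Isometry

variable {B : Type*} [CStarAlgebra B] {s : B} (hs : star s * s = 1)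

open Classical in
/-- The `*`-homomorphism that sends `S e + S f` to the isometry `s`. -/
def isometryHom : E.CStar →⋆ₙₐ[ℂ] B := lift _ _ (hE.isCuntzKrieger_isometry hs)

theorem isometryHom_P : hE.isometryHom hs (E.P v) = s * star s := (lift_P _ v).trans (if_pos rfl)

theorem isometryHom_P_sink : hE.isometryHom hs (E.P w) = 1 - s * star s :=
  (lift_P _ w).trans (if_neg hE.ne.symm)

theorem isometryHom_S : hE.isometryHom hs (E.S e) = s * (s * star s) :=
  (lift_S _ e).trans (if_pos rfl)

theorem isometryHom_S_sink : hE.isometryHom hs (E.S f) = s * (1 - s * star s) :=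
  (lift_S _ f).trans (if_neg hE.e_ne_f.symm)

theorem isometryHom_S_add_S : hE.isometryHom hs (E.S e + E.S f) = s := by
  rw [map_add, isometryHom_S, isometryHom_S_sink, ← mul_add, add_sub_cancel, mul_one]

theorem isometryHom_P_add_P : hE.isometryHom hs (E.P v + E.P w) = 1 := by
  rw [map_add, isometryHom_P, isometryHom_P_sink, add_sub_cancel]

theorem map_isometryHom {C : Type*} [CStarAlgebra C] (g : B →⋆ₐ[ℂ] C) {t : C}
    (ht : star t * t = 1) (hg : g s = t) (x : E.CStar) :
    g (hE.isometryHom hs x) = hE.isometryHom ht x := by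
  have h : (g : B →⋆ₙₐ[ℂ] C).comp (hE.isometryHom hs) = hE.isometryHom ht := by
    refine hom_ext (fun u => ?_) fun r => ?_
    · change g (hE.isometryHom hs _) = _
      rcases hE.vert u with rfl | rfl
      · rw [isometryHom_P, isometryHom_P, map_mul, map_star, hg]
      · rw [isometryHom_P_sink, isometryHom_P_sink, map_sub, map_one, map_mul, map_star, hg]
    · change g (hE.isometryHom hs _) = _
      rcases hE.edge r with rfl | rfl
      · rw [isometryHom_S, isometryHom_S, map_mul, map_mul, map_star, hg]
      · rw [isometryHom_S_sink, isometryHom_S_sink, map_mul, map_sub, map_one, map_mul, map_star,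
          hg]
  exact DFunLike.congr_fun h x

end Isometry

/-- The quotient by the sink, with values in `C(S¹)`. -/
def quotientHom : E.CStar →⋆ₙₐ[ℂ] C(Circle, ℂ) :=
  (loopHom hE.quotient_vert hE.quotient_edge).comp (quotientMap hE.sink)

/-- The isometry u is unitary, so 1 - uu* = 0 and the sink generators are killed: the homomorphism
given by u is the one that factors through the removal of the sink. -/
theorem isometryHom_u (x : E.CStar) : hE.isometryHom star_u_mul_u x = hE.quotientHom x := by
  have h : hE.isometryHom star_u_mul_u = hE.quotientHom := by
    refine hom_ext (fun r => ?_) fun r => ?_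
    · change _ = loopHom hE.quotient_vert hE.quotient_edge (quotientMap _ _)
      rcases hE.vert r with rfl | rfl
      · rw [isometryHom_P, quotientMap_P hE.notMem_sink, loopHom_P, u_mul_star_u]
      · rw [isometryHom_P_sink, quotientMap_P_of_mem (H := hE.sink) rfl, map_zero, u_mul_star_u, sub_self]
    · change _ = loopHom hE.quotient_vert hE.quotient_edge (quotientMap _ _)
      rcases hE.edge r with rfl | rfl
      · rw [isometryHom_S, quotientMap_S hE.rng_notMem_sink, loopHom_S, u_mul_star_u, mul_one]
      · rw [isometryHom_S_sink, quotientMap_S_of_mem (H := hE.sink) hE.rng_f, map_zero, u_mul_star_u,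
          sub_self, mul_zero]
  exact DFunLike.congr_fun h x

set_option synthInstance.maxHeartbeats 400000 in
/-- The representation of `C*(E)` on `ℓ²(ℕ)`. -/
def toeplitzHom : E.CStar →⋆ₙₐ[ℂ] ToeplitzAlgebra :=
  hE.isometryHom (B := ToeplitzAlgebra) star_s_mul_s

set_option synthInstance.maxHeartbeats 400000 in
theorem symbol_toeplitzHom (x : E.CStar) : symbol (hE.toeplitzHom x) = hE.quotientHom x :=
  (hE.map_isometryHom (B := ToeplitzAlgebra) star_s_mul_s symbol star_u_mul_u symbol_s x).trans (hE.isometryHom_u x)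

theorem mem_closedIdeal_of_quotientHom_eq_zero {x : E.CStar} (hx : hE.quotientHom x = 0) :
    x ∈ E.closedIdeal {w} := by
  refine ((isQuotientBy_quotientMap hE.sink).2 x).1 ?_
  exact injective_loopHom hE.quotient_vert hE.quotient_edge (hx.trans (map_zero _).symm)

theorem quotientHom_gauge (z : Circle) (x : E.CStar) :
    hE.quotientHom (E.gauge z x) = circleRotation z (hE.quotientHom x) := by
  change loopHom hE.quotient_vert hE.quotient_edge (quotientMap _ _) =
    circleRotation z (loopHom hE.quotient_vert hE.quotient_edge (quotientMap _ _))
  rw [quotientMap_gauge, loopHom_gauge]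

-- If the representation kills x, so does its composition with σ, which is the quotient by the sink;
-- thus x lies in the ideal of the sink. On that ideal the representation is faithful because the
-- sink projection acts as 1 - ss* ≠ 0.
set_option synthInstance.maxHeartbeats 400000 in
theorem injective_toeplitzHom : Function.Injective hE.toeplitzHom := by
  refine (injective_iff_map_eq_zero _).2 fun x hx => ?_
  refine eq_zero_of_mem_closedIdeal_sink hE.isSink (B := ToeplitzAlgebra) (f := hE.toeplitzHom) ?_
    (hE.mem_closedIdeal_of_quotientHom_eq_zero ?_) hx
  · rw [toeplitzHom, isometryHom_P_sink]
    exact one_sub_s_mul_star_s_ne_zero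
  · rw [← symbol_toeplitzHom, hx, map_zero]

set_option synthInstance.maxHeartbeats 400000 in
theorem bijective_toeplitzHom : Function.Bijective hE.toeplitzHom := by
  refine ⟨hE.injective_toeplitzHom, fun y => ?_⟩
  -- Surjectivity is read off inside the algebra of all operators, where 𝒯 is by definition the
  -- closed unital `*`-subalgebra generated by the shift.
  let i : ToeplitzAlgebra →⋆ₙₐ[ℂ] (L2 →L[ℂ] L2) :=
    ((StarAlgebra.elemental ℂ shift).subtype : ToeplitzAlgebra →⋆ₐ[ℂ] (L2 →L[ℂ] L2))
  have hi : Function.Injective (i.comp hE.toeplitzHom) :=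
    Subtype.val_injective.comp hE.injective_toeplitzHom
  obtain ⟨x, hx⟩ := StarAlgebra.elemental_subset_range hi (x := shift)
    ⟨E.S e + E.S f, congrArg i (hE.isometryHom_S_add_S star_s_mul_s)⟩
    ⟨E.P v + E.P w, congrArg i (hE.isometryHom_P_add_P star_s_mul_s)⟩ y.2
  exact ⟨x, Subtype.ext hx⟩

set_option synthInstance.maxHeartbeats 400000 in
/-- `C*(E)` is the Toeplitz algebra. -/
def toeplitzEquiv : E.CStar ≃⋆ₐ[ℂ] ToeplitzAlgebra :=
  StarAlgEquiv.ofBijective hE.toeplitzHom hE.bijective_toeplitzHom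

end IsToeplitzGraph

end RowFiniteGraph

end

/-! ### The lens graphs and their pullback square. -/

noncomputable section

namespace LensGraph

open RowFiniteGraph Toeplitz

variable (k : ℕ)

/-! ### The quotients of the lens graphs -/

theorem v0_notMem_HL : LensVertex.v0 ∉ (HL k).carrier := fun ⟨_, hi⟩ => nomatch hi

theorem LH.vert (v : ((L3 k).quotient (HL k)).Vert) : v = toQuotVert (v0_notMem_HL k) := by
  obtain ⟨_ | i, hv⟩ := v
  · rfl
  · exact absurd ⟨i, rfl⟩ hv

theorem LH.edge (e : ((L3 k).quotient (HL k)).Edge) : e = LH.e0 k := by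
  obtain ⟨_ | i | i, he⟩ := e
  · rfl
  · exact absurd ⟨i, rfl⟩ he
  · exact absurd ⟨i, rfl⟩ he

/-- The vertex `v⁰₀` of `Q_l`. -/
def Q.v0 : (Q k).Vert := LensVertex.v0

/-- The vertices `v¹_i` of `Q_l`. -/
def Q.v1 {k : ℕ} (i : Fin (k + 1)) : (Q k).Vert := LensVertex.v1 i

/-- The loops `e¹_i`, `i < k`, of `Q_l`, `l = k + 1`. -/
def Q.e1 {k : ℕ} (i : Fin k) : (Q k).Edge :=
  ⟨LensEdge.e1 i.castSucc, fun h => (Fin.castSucc_lt_last i).ne (LensEdge.e1.inj h)⟩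

theorem v0_notMem_H : Q.v0 k ∉ (H k).carrier := fun ⟨_, hi⟩ => nomatch hi

theorem last_notMem_H : Q.v1 (Fin.last k) ∉ (H k).carrier :=
  fun ⟨i, hi⟩ => (Fin.castSucc_lt_last i).ne (LensVertex.v1.inj hi).symm

/-- The vertices `v¹_i` of `L³_k`. -/
def L.v1 {k : ℕ} (i : Fin k) : (L3 k).Vert := LensVertex.v1 i

/-- The loop `e⁰₀` of `L³_k`. -/
def L.e0 : (L3 k).Edge := LensEdge.e0

/-- The edges `e⁰¹_i` of `L³_k`. -/
def L.e01 {k : ℕ} (i : Fin k) : (L3 k).Edge := LensEdge.e01 i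

/-- The loops `e¹_i` of `L³_k`. -/
def L.e1 {k : ℕ} (i : Fin k) : (L3 k).Edge := LensEdge.e1 i

variable {k} in
theorem v1_mem_HL (i : Fin k) : L.v1 i ∈ (HL k).carrier := ⟨i, rfl⟩

variable {k} in
theorem castSucc_mem_H (i : Fin k) : Q.v1 i.castSucc ∈ (H k).carrier := ⟨i, rfl⟩

/-- Without `H` there remain v⁰₀ with its loop, the last vertex, and the edge between them; the last
vertex is a sink since its loop is not an edge of Q_l. -/
theorem isToeplitzGraph_QH : IsToeplitzGraph ((Q k).quotient (H k))
    (toQuotVert (v0_notMem_H k)) (toQuotVert (last_notMem_H k)) (QH.e0 k) (QH.e01 k) where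
  ne h := nomatch congrArg Subtype.val h
  src_e := rfl
  rng_e := rfl
  src_f := rfl
  rng_f := rfl
  vert v := by
    obtain ⟨_ | i, hv⟩ := v
    · exact .inl rfl
    · induction i using Fin.lastCases with
      | last => exact .inr rfl
      | cast i => exact absurd (castSucc_mem_H i) hv
  edge e := by
    obtain ⟨⟨_ | i | i, hi⟩, he⟩ := e
    · exact .inl rfl
    · induction i using Fin.lastCases with
      | last => exact .inr rfl
      | cast i => exact absurd (castSucc_mem_H i) he
    · induction i using Fin.lastCases with
      | last => exact absurd rfl hi
      | cast i => exact absurd (castSucc_mem_H i) he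

/-! ### The map `χ₁` -/

theorem bijective_lensIso_symm_map : Function.Bijective (lensIso k).symm.map :=
  (lensIso k).symm.bijective_map

theorem isQuotientBy_chi1 : IsQuotientBy (chi1 k) ((Q k).closedIdeal (lastVertex k).carrier) := by
  have h := isQuotientBy_quotientMap (lastVertex k)
  refine ⟨(bijective_lensIso_symm_map k).2.comp h.1, fun x => (Iff.trans ?_ (h.2 x))⟩
  exact map_eq_zero_iff (lensIso k).symm.map (bijective_lensIso_symm_map k).1

theorem chi1_gauge (z : Circle) (x : (Q k).CStar) :
    chi1 k ((Q k).gauge z x) = (L3 k).gauge z (chi1 k x) := by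
  change (lensIso k).symm.map (quotientMap _ _) = _
  rw [quotientMap_gauge, Iso.map_gauge]
  rfl

variable {k} in
theorem chi1_P (v : (L3 k).Vert) : chi1 k ((Q k).P (isoVert k v).1) = (L3 k).P v := by
  change (lensIso k).symm.map (quotientMap (lastVertex k) _) = _
  rw [quotientMap_P (isoVert k v).2, Iso.map_P]
  exact congrArg (L3 k).P ((lensIso k).vert.symm_apply_apply v)

variable {k} in
theorem chi1_S (e : (L3 k).Edge) : chi1 k ((Q k).S (isoEdge k e).1) = (L3 k).S e := by
  change (lensIso k).symm.map (quotientMap (lastVertex k) _) = _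
  rw [quotientMap_S (isoEdge k e).2, Iso.map_S]
  exact congrArg (L3 k).S ((lensIso k).edge.symm_apply_apply e)

theorem last_mem : Q.v1 (Fin.last k) ∈ (lastVertex k).carrier := rfl

theorem chi1_P_last : chi1 k ((Q k).P (Q.v1 (Fin.last k))) = 0 := by
  change (lensIso k).symm.map (quotientMap (lastVertex k) _) = _
  rw [quotientMap_P_of_mem (v := Q.v1 (Fin.last k)) (last_mem k), map_zero]

theorem chi1_S_last : chi1 k ((Q k).S (Q.e01 (Fin.last k))) = 0 := by
  change (lensIso k).symm.map (quotientMap (lastVertex k) _) = _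
  rw [quotientMap_S_of_mem (e := Q.e01 (Fin.last k)) (last_mem k), map_zero]

/-! ### The pullback diagram -/

/-- The identification of `C*(L³_{l-1} / H)` with `C(S¹)`. -/
def kappa : ((L3 k).quotient (HL k)).CStar ≃⋆ₐ[ℂ] C(Circle, ℂ) :=
  loopEquiv (LH.vert k) (LH.edge k)

theorem kappa_apply (x : ((L3 k).quotient (HL k)).CStar) :
    kappa k x = loopHom (LH.vert k) (LH.edge k) x := rfl

/-- Both composites send the projection of v⁰₀ to 1, its loop to u, and every other generator to 0.
-/
theorem comm_chi1 (x : (Q k).CStar) :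
    kappa k (quotientMap (HL k) (chi1 k x)) =
      (isToeplitzGraph_QH k).quotientHom (quotientMap (H k) x) := by
  have hQ := isToeplitzGraph_QH k
  have h : ((kappa k : _ →⋆ₙₐ[ℂ] C(Circle, ℂ)).comp (quotientMap (HL k))).comp (chi1 k) =
      hQ.quotientHom.comp (quotientMap (H k)) := by
    refine hom_ext (fun v => ?_) fun e => ?_
    · change kappa k (quotientMap (HL k) (chi1 k _)) = hQ.quotientHom (quotientMap (H k) _)
      rcases v with _ | i
      · have h1 : chi1 k ((Q k).P (Q.v0 k)) = _ := chi1_P LensVertex.v0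
        change kappa k (quotientMap (HL k) (chi1 k ((Q k).P (Q.v0 k)))) =
          hQ.quotientHom (quotientMap (H k) ((Q k).P (Q.v0 k)))
        rw [h1, quotientMap_P (v0_notMem_HL k), quotientMap_P (v0_notMem_H k), kappa_apply,
          loopHom_P, ← hQ.isometryHom_u, hQ.isometryHom_P, u_mul_star_u]
      · induction i using Fin.lastCases with
        | last =>
          change kappa k (quotientMap (HL k) (chi1 k ((Q k).P (Q.v1 (Fin.last k))))) =
            hQ.quotientHom (quotientMap (H k) ((Q k).P (Q.v1 (Fin.last k))))
          rw [chi1_P_last, map_zero, map_zero, quotientMap_P (last_notMem_H k), ← hQ.isometryHom_u,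
            hQ.isometryHom_P_sink, u_mul_star_u, sub_self]
        | cast i =>
          have h1 : chi1 k ((Q k).P (Q.v1 i.castSucc)) = _ := chi1_P (L.v1 i)
          change kappa k (quotientMap (HL k) (chi1 k ((Q k).P (Q.v1 i.castSucc)))) =
            hQ.quotientHom (quotientMap (H k) ((Q k).P (Q.v1 i.castSucc)))
          rw [h1, quotientMap_P_of_mem (v1_mem_HL i),
            quotientMap_P_of_mem (castSucc_mem_H i), map_zero, map_zero]
    · change kappa k (quotientMap (HL k) (chi1 k _)) = hQ.quotientHom (quotientMap (H k) _)
      obtain ⟨_ | i | i, hi⟩ := e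
      · have h1 : chi1 k ((Q k).S (Q.e0 k)) = _ := chi1_S (L.e0 k)
        change kappa k (quotientMap (HL k) (chi1 k ((Q k).S (Q.e0 k)))) =
          hQ.quotientHom (quotientMap (H k) ((Q k).S (Q.e0 k)))
        rw [h1, quotientMap_S (e := L.e0 k) (LH.e0 k).2,
          quotientMap_S (e := Q.e0 k) (QH.e0 k).2, kappa_apply, loopHom_S,
          ← hQ.isometryHom_u]
        refine Eq.trans ?_ (hQ.isometryHom_S star_u_mul_u).symm
        rw [u_mul_star_u, mul_one]
      · induction i using Fin.lastCases with
        | last =>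
          change kappa k (quotientMap (HL k) (chi1 k ((Q k).S (Q.e01 (Fin.last k))))) =
            hQ.quotientHom (quotientMap (H k) ((Q k).S (Q.e01 (Fin.last k))))
          rw [chi1_S_last, map_zero, map_zero, quotientMap_S (e := Q.e01 (Fin.last k)) (QH.e01 k).2, ← hQ.isometryHom_u]
          refine Eq.trans ?_ (hQ.isometryHom_S_sink star_u_mul_u).symm
          rw [u_mul_star_u, sub_self, mul_zero]
        | cast i =>
          have h1 : chi1 k ((Q k).S (Q.e01 i.castSucc)) = _ := chi1_S (L.e01 i)
          change kappa k (quotientMap (HL k) (chi1 k ((Q k).S (Q.e01 i.castSucc)))) =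
            hQ.quotientHom (quotientMap (H k) ((Q k).S (Q.e01 i.castSucc)))
          rw [h1, quotientMap_S_of_mem (e := L.e01 i) (v1_mem_HL i),
            quotientMap_S_of_mem (e := Q.e01 i.castSucc) (castSucc_mem_H i), map_zero, map_zero]
      · induction i using Fin.lastCases with
        | last => exact absurd rfl hi
        | cast i =>
          have h1 : chi1 k ((Q k).S (Q.e1 i)) = _ := chi1_S (L.e1 i)
          change kappa k (quotientMap (HL k) (chi1 k ((Q k).S (Q.e1 i)))) =
            hQ.quotientHom (quotientMap (H k) ((Q k).S (Q.e1 i)))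
          rw [h1, quotientMap_S_of_mem (e := L.e1 i) (v1_mem_HL i),
            quotientMap_S_of_mem (e := Q.e1 i) (castSucc_mem_H i), map_zero, map_zero]
  exact DFunLike.congr_fun h x

theorem isSink_last : (Q k).IsSink (Q.v1 (Fin.last k)) := by
  rintro ⟨_ | i | i, hi⟩ h
  · exact nomatch h
  · exact nomatch h
  · exact hi (congrArg LensEdge.e1 (LensVertex.v1.inj h))

/-- `H` is hereditary and does not contain the last vertex, so no path leads from `H` to this sink.
-/
theorem P_mul_mul_P_lastVertex (v) (hv : v ∈ (H k).carrier) (w) (hw : w ∈ (lastVertex k).carrier)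
    (a : (Q k).CStar) : (Q k).P v * a * (Q k).P w = 0 := by
  obtain rfl : w = Q.v1 (Fin.last k) := hw
  exact P_mul_mul_P_eq_zero (isSink_last k)
    (fun h => last_notMem_H k ((H k).hereditary _ _ h hv)) a

/-- The difference lies in the kernels of both quotient maps, and these intersect in zero. -/
theorem eq_of_chi1_eq {x y : (Q k).CStar} (h1 : chi1 k x = chi1 k y)
    (h2 : quotientMap (H k) x = quotientMap (H k) y) : x = y := by
  rw [← sub_eq_zero]
  refine eq_zero_of_mem_inter (P_mul_mul_P_lastVertex k) (((isQuotientBy_chi1 k).2 _).1 ?_) ?_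
  · rw [map_sub, h1, sub_self]
  · rw [map_sub, h2, sub_self]

theorem exists_chi1_eq {a : (L3 k).CStar} {b : ((Q k).quotient (H k)).CStar}
    (h : kappa k (quotientMap (HL k) a) = (isToeplitzGraph_QH k).quotientHom b) :
    ∃ x, chi1 k x = a ∧ quotientMap (H k) x = b := by
  obtain ⟨x, rfl⟩ := (isQuotientBy_chi1 k).1 a
  rw [comm_chi1] at h
  -- Since x already lifts a, the defect of x in the second coordinate has zero symbol, so it lies
  -- in the ideal of the sink of Q_l/H.
  have hy := (isToeplitzGraph_QH k).mem_closedIdeal_of_quotientHom_eq_zero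
    (x := b - quotientMap (H k) x) (by rw [map_sub, h, sub_self])
  -- The defect lifts to an element of ker χ₁, so adding it repairs the second coordinate and leaves
  -- the first unchanged.
  obtain ⟨j, hj, hjb⟩ := exists_mem_closedIdeal_quotientMap_eq (P_mul_mul_P_lastVertex k)
    (by rintro _ rfl; rfl) hy
  refine ⟨x + j, ?_, ?_⟩
  · rw [map_add, ((isQuotientBy_chi1 k).2 j).2 hj, add_zero]
  · rw [map_add, hjb, add_sub_cancel]

end LensGraph

end

/-- Here `l = k + 1`. The isomorphisms `θ : C*(Q_l / H) ≅ 𝒯` and `κ : C*(L³_{l-1} / H) ≅ C(S¹)` are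
the standard identifications; they are determined by the stated values. The maps `χ₂` and `g` are
the quotient maps `quotientMap (H k)` and `quotientMap (HL k)` followed by `θ` and `κ`. -/
theorem mainTheorem5 (k : ℕ) :
    ∃ (θ : ((LensGraph.Q k).quotient (LensGraph.H k)).CStar ≃⋆ₐ[ℂ] Toeplitz.ToeplitzAlgebra)
      (κ : ((LensGraph.L3 k).quotient (LensGraph.HL k)).CStar ≃⋆ₐ[ℂ] C(Circle, ℂ)),
      -- the identifications
      θ (RowFiniteGraph.S _ (LensGraph.QH.e0 k) + RowFiniteGraph.S _ (LensGraph.QH.e01 k)) =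
        Toeplitz.s ∧
      κ (RowFiniteGraph.S _ (LensGraph.LH.e0 k)) = Toeplitz.u ∧
      -- the maps are the quotient maps by the closed ideals generated by the vertex projections
      IsQuotientBy (LensGraph.chi1 k)
        ((LensGraph.Q k).closedIdeal (LensGraph.lastVertex k).carrier) ∧
      IsQuotientBy (RowFiniteGraph.quotientMap (LensGraph.H k))
        ((LensGraph.Q k).closedIdeal (LensGraph.H k).carrier) ∧
      IsQuotientBy (RowFiniteGraph.quotientMap (LensGraph.HL k))
        ((LensGraph.L3 k).closedIdeal (LensGraph.HL k).carrier) ∧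
      -- the four maps are equivariant; `𝒯` carries the gauge action of `C*(Q_l / H)`
      (∀ z x, LensGraph.chi1 k ((LensGraph.Q k).gauge z x) =
        (LensGraph.L3 k).gauge z (LensGraph.chi1 k x)) ∧
      (∀ z x, RowFiniteGraph.quotientMap (LensGraph.H k) ((LensGraph.Q k).gauge z x) =
        RowFiniteGraph.gauge _ z (RowFiniteGraph.quotientMap (LensGraph.H k) x)) ∧
      (∀ z x, κ (RowFiniteGraph.quotientMap (LensGraph.HL k) ((LensGraph.L3 k).gauge z x)) =
        circleRotation z (κ (RowFiniteGraph.quotientMap (LensGraph.HL k) x))) ∧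
      (∀ z y, Toeplitz.symbol (θ (RowFiniteGraph.gauge _ z y)) =
        circleRotation z (Toeplitz.symbol (θ y))) ∧
      -- the pullback diagram
      IsPullbackDiagram (B₂ := Toeplitz.ToeplitzAlgebra) (D := C(Circle, ℂ))
        (LensGraph.chi1 k)
        ((θ : _ →⋆ₙₐ[ℂ] Toeplitz.ToeplitzAlgebra).comp
          (RowFiniteGraph.quotientMap (LensGraph.H k)))
        ((κ : _ →⋆ₙₐ[ℂ] C(Circle, ℂ)).comp (RowFiniteGraph.quotientMap (LensGraph.HL k)))
        (Toeplitz.symbol : Toeplitz.ToeplitzAlgebra →⋆ₙₐ[ℂ] C(Circle, ℂ)) := by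
  have hQ := LensGraph.isToeplitzGraph_QH k
  refine ⟨hQ.toeplitzEquiv, LensGraph.kappa k, hQ.isometryHom_S_add_S Toeplitz.star_s_mul_s,
    RowFiniteGraph.loopHom_S (LensGraph.LH.vert k) (LensGraph.LH.edge k) _, LensGraph.isQuotientBy_chi1 k,
    RowFiniteGraph.isQuotientBy_quotientMap _, RowFiniteGraph.isQuotientBy_quotientMap _,
    LensGraph.chi1_gauge k, RowFiniteGraph.quotientMap_gauge _, fun z x => ?_, fun z y => ?_,
    fun x => ?_, fun a b hab => ?_⟩
  · rw [RowFiniteGraph.quotientMap_gauge]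
    exact RowFiniteGraph.loopHom_gauge (LensGraph.LH.vert k) (LensGraph.LH.edge k) z _
  · change Toeplitz.symbol (hQ.toeplitzHom _) = circleRotation z (Toeplitz.symbol (hQ.toeplitzHom _))
    rw [hQ.symbol_toeplitzHom, hQ.symbol_toeplitzHom, hQ.quotientHom_gauge]
  · exact (LensGraph.comm_chi1 k x).trans (hQ.symbol_toeplitzHom _).symm
  -- The second coordinate is moved back from 𝒯 to C*(Q_l/H), where the lifting and uniqueness
  -- statements live.
  · obtain ⟨b, rfl⟩ := hQ.toeplitzEquiv.surjective b
    obtain ⟨x, hx, hx'⟩ := LensGraph.exists_chi1_eq k (hab.trans (hQ.symbol_toeplitzHom b))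
    refine ⟨x, ⟨hx, congrArg hQ.toeplitzHom hx'⟩, fun y hy => ?_⟩
    exact LensGraph.eq_of_chi1_eq k (hy.1.trans hx.symm)
      ((hQ.injective_toeplitzHom hy.2).trans hx'.symm)
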